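/- Let $X$ be a real or complex Banach space and let $B_1,\dots,B_r$ generate $C_0$-semigroups $(T_{B_j}(t))_{t\ge0}$ on $X$ with $T_{B_j}(t)T_{B_k}(s)=T_{B_k}(s)T_{B_j}(t)$ for all $j,k$ and $s,t\ge 0$. Let $n\ge1$ and let $A_1,\dots,A_n$ be a list of operators in which each $B_j$ occurs exactly $S_j\ge1$ times and nothing else occurs, so $\sum_jS_j=n$. Let $T>0$ and $f:[0,T]\to X$. Assume: (A1)$'$ $B_j-B_k$ (with domain $D(B_j)\cap D(B_k)$) is injective for $j\ne k$. (A2)$'$ The ranges of the $B_j-B_k$ are large enough for $f$, in the following sense. For a finite (possibly empty) sequence $(l_1,\dots,l_m)$ of indices different from $j$ let $\mathcal R_j(l_1,\dots,l_m)$ be defined recursively: $\mathcal R_j()=C([0,T];X)$, and $g\in\mathcal R_j(l_1,\dots,l_m)$ for $m\ge1$ if $g\in C([0,T];X)$ and there is $h$ with $h(s)\in D(B_j)\cap D(B_{l_1})$, $(B_j-B_{l_1})h(s)=g(s)$ for all $s\in[0,T]$, and with $h$ and $B_jh$ both in $\mathcal R_j(l_2,\dots,l_m)$. Then for each $j$,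 $f\in\mathcal R_j(l_1,\dots,l_{n-1})$ for every sequence $l_1,\dots,l_{n-1}$ of indices different from $j$ in which every $l\ne j$ occurs at least $S_l$ times. (H1) $f\in C^1([0,T];X)$, and for some $a$, $f(t)\in D(A_a)$ for all $t\in[0,T]$ and $A_af\in C([0,T];X)$. Moreover $f(0)\neq0$. Let $M_n$ be the $n\times n$ matrix of operators whose columns are indexed by the pairs $(j,k)$ with $0\le k<S_j$ and whose entry in row $i$ ($0\le i\le n-1$) is $\binom ik B_j^{\,i-k}$ for $i\ge k$ and $0$ for $i<k$; it acts in $X^n$, on the vectors to which all its entries apply. Then: (a) $M_n$ is injective. Hence $M_n^{-1}(0,\dots,0,I)^T=z$ determines linear operators $z=(Z(n,j,k))_{j,\,k<S_j}$: for $y$ such that $(0,\dots,0,y)^T$ lies in the range of $M_n$, $(Z(n,j,k)y)_{j,k}$ is the unique vector mapped to it by $M_n$. (In the linear numbering, $Z(n,j,k)=Z(n,S_1+\dots+S_{j-1}+k)$.) (b) For every $s\in[0,T]$, $f(s)$ lies in the domain of every $Z(n,j,k)$, and $s\mapsto Z(n,j,k)f(s)$ is continuous on $[0,T]$. (c) The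 function $$u(t)=\sum_{j=1}^r\sum_{k=0}^{S_j-1}\int_0^t\frac{(t-s)^k}{k!}\,T_{B_j}(t-s)\,Z(n,j,k)f(s)\,ds$$ is not identically zero on $[0,T]$, and it is the unique solution on $[0,T]$ of $\prod_{a=1}^n\bigl(\frac{d}{dt}-A_a\bigr)u=f$ with zero initial data. Here $u$ solves the equation if there are functions $u_1=u,u_2,\dots,u_{n+1}=f$ such that for $1\le a\le n$ the function $u_a$ is $C^1$ on $[0,T]$ (one-sided at the end points), $u_a(t)\in D(A_a)$ and $u_a'(t)=A_au_a(t)+u_{a+1}(t)$ for all $t\in[0,T]$; zero initial data means $u_a(0)=0$ for $1\le a\le n$. (d) If a solution $u$ of the equation in this sense is $C^{n-1}$ on $[0,T]$, then $u_a(0)=0$ for $1\le a\le n$ if and only if $u^{(k)}(0)=0$ for $0\le k\le n-1$; so every solution $u\in C^{n-1}([0,T];X)$ of the equation with $u^{(k)}(0)=0$, $0\le k\le n-1$, is given by the formula in (c). -/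

import Mathlib

open Set Filter Topology
open scoped NNReal

/-- A strongly continuous (`C₀`-) semigroup of bounded linear operators on `X`. -/
structure C0Semigroup (𝕜 X : Type*) [RCLike 𝕜] [NormedAddCommGroup X] [NormedSpace 𝕜 X] where
  /-- the operator at time `t ≥ 0` -/
  op : ℝ≥0 → X →L[𝕜] X
  op_zero : op 0 = ContinuousLinearMap.id 𝕜 X
  op_add : ∀ s t : ℝ≥0, op (s + t) = (op s).comp (op t)
  continuous_op : ∀ x : X, Continuous fun t : ℝ≥0 => op t x

section Operators

variable {𝕜 X : Type*} [RCLike 𝕜] [NormedAddCommGroup X] [NormedSpace 𝕜 X]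

/-- The difference quotient `(T(h)x - x)/h` converges to `y` as `h → 0+`. -/
def C0Semigroup.HasGen [NormedSpace ℝ X] (T : C0Semigroup 𝕜 X) (x y : X) : Prop :=
  Tendsto (fun h : ℝ => h⁻¹ • (T.op h.toNNReal x - x)) (𝓝[>] 0) (𝓝 y)

theorem C0Semigroup.HasGen.add [NormedSpace ℝ X] {T : C0Semigroup 𝕜 X} {x y x' y' : X}
    (h : T.HasGen x y) (h' : T.HasGen x' y') : T.HasGen (x + x') (y + y') := by
  refine (Tendsto.add h h').congr fun s => ?_
  rw [map_add, ← smul_add]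
  congr 1
  abel

theorem C0Semigroup.HasGen.smul [NormedSpace ℝ X] [IsScalarTower ℝ 𝕜 X] {T : C0Semigroup 𝕜 X}
    {x y : X} (c : 𝕜) (h : T.HasGen x y) : T.HasGen (c • x) (c • y) := by
  refine (Tendsto.const_smul h c).congr fun s => ?_
  rw [map_smul, ← smul_sub, smul_comm]

theorem C0Semigroup.HasGen.zero [NormedSpace ℝ X] (T : C0Semigroup 𝕜 X) : T.HasGen 0 0 := by
  simp [C0Semigroup.HasGen]

/-- The infinitesimal generator of a `C₀`-semigroup, on its natural domain
`{x | lim_{h → 0+} (T(h)x - x)/h exists}`. -/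
noncomputable def C0Semigroup.generator [NormedSpace ℝ X] [IsScalarTower ℝ 𝕜 X]
    (T : C0Semigroup 𝕜 X) : X →ₗ.[𝕜] X where
  domain :=
    { carrier := {x | ∃ y, T.HasGen x y}
      add_mem' := fun ⟨y, hy⟩ ⟨y', hy'⟩ => ⟨y + y', hy.add hy'⟩
      zero_mem' := ⟨0, C0Semigroup.HasGen.zero T⟩
      smul_mem' := fun c _ ⟨y, hy⟩ => ⟨c • y, hy.smul c⟩ }
  toFun :=
    { toFun := fun x => x.2.choose
      map_add' := fun x y =>
        tendsto_nhds_unique (x + y).2.choose_spec (x.2.choose_spec.add y.2.choose_spec)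
      map_smul' := fun c x =>
        tendsto_nhds_unique (c • x).2.choose_spec (x.2.choose_spec.smul c) }

theorem C0Semigroup.mem_graph_generator [NormedSpace ℝ X] [IsScalarTower ℝ 𝕜 X]
    (T : C0Semigroup 𝕜 X) (x y : X) : (x, y) ∈ T.generator.graph ↔ T.HasGen x y := by
  rw [LinearPMap.mem_graph_iff]
  constructor
  · rintro ⟨a, rfl, rfl⟩
    exact a.2.choose_spec
  · intro h
    exact ⟨⟨x, y, h⟩, rfl, tendsto_nhds_unique (Exists.choose_spec (⟨y, h⟩ : ∃ y, T.HasGen x y)) h⟩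

/-- The composition `C ∘ B` of partially defined operators, on its natural domain
`{x ∈ D(B) | B x ∈ D(C)}`. -/
def partialComp (C B : X →ₗ.[𝕜] X) : X →ₗ.[𝕜] X where
  domain := (C.domain.comap B.toFun).map B.domain.subtype
  toFun :=
    { toFun := fun x => C ⟨B ⟨x, by
          obtain ⟨a, -, ha⟩ := x.2
          rw [← ha]; exact a.2⟩, by
          obtain ⟨a, h, ha⟩ := x.2
          have : (⟨(x : X), ha ▸ a.2⟩ : B.domain) = a := Subtype.ext ha.symm
          rw [this]; exact h⟩
      map_add' := fun x y => by
        rw [← C.map_add]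
        congr 1
        ext
        exact B.map_add ⟨x, _⟩ ⟨y, _⟩
      map_smul' := fun c x => by
        rw [RingHom.id_apply, ← C.map_smul]
        congr 1
        ext
        exact B.map_smul c ⟨x, _⟩ }

/-- The power `B ^ m` of an unbounded operator, on its natural domain. -/
def partialPow (B : X →ₗ.[𝕜] X) : ℕ → (X →ₗ.[𝕜] X)
  | 0 => (LinearMap.id : X →ₗ[𝕜] X).toPMap ⊤
  | m + 1 => partialComp (partialPow B m) B

/-- The operator matrix `M_n = [(B_1)_{S_1} (B_2)_{S_2} ⋯ (B_r)_{S_r}]` with `n` rows. The columns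
are indexed by the pairs `(j, k)`, `k < S_j`, and the entry in row `i` and column `(j, k)` is
`C(i, k) B_j ^ (i - k)`. It acts on column vectors with entries in `X`, and its domain consists of
the vectors to which every entry of the matrix can be applied. For `i < k` the binomial
coefficient is `0` and the power `B_j ^ (i - k)` is the identity by truncated subtraction, so that
the entry is the everywhere defined operator `0`. -/
def opMatrix {r : ℕ} (n : ℕ) (B : Fin r → X →ₗ.[𝕜] X) (S : Fin r → ℕ) :
    ((p : Σ j : Fin r, Fin (S j)) → X) →ₗ.[𝕜] (Fin n → X) where
  domain := ⨅ (i : Fin n) (p : Σ j : Fin r, Fin (S j)),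
    (partialPow (B p.1) ((i : ℕ) - (p.2 : ℕ))).domain.comap (LinearMap.proj p)
  toFun :=
    { toFun := fun z i => ∑ p : Σ j : Fin r, Fin (S j), ((i : ℕ).choose (p.2 : ℕ) : 𝕜) •
        partialPow (B p.1) ((i : ℕ) - (p.2 : ℕ)) ⟨z.1 p, by
          have h := z.2
          simp only [Submodule.mem_iInf] at h
          exact h i p⟩
      map_add' := fun z w => by
        funext i
        rw [Pi.add_apply, ← Finset.sum_add_distrib]
        refine Finset.sum_congr rfl fun p _ => ?_
        rw [← smul_add, ← LinearPMap.map_add]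
        rfl
      map_smul' := fun c z => by
        funext i
        rw [RingHom.id_apply, Pi.smul_apply, Finset.smul_sum]
        refine Finset.sum_congr rfl fun p _ => ?_
        rw [smul_comm c]
        congr 1
        rw [← LinearPMap.map_smul]
        rfl }

/-- The operator column vector `h = (0, …, 0, I)ᵀ` of length `n`. -/
def lastUnit (𝕜 X : Type*) [RCLike 𝕜] [NormedAddCommGroup X] [NormedSpace 𝕜 X] (n : ℕ) :
    X →ₗ[𝕜] (Fin n → X) :=
  LinearMap.pi fun i => if (i : ℕ) + 1 = n then LinearMap.id else 0

/-- The `p`-th component `Z(n, p)` of the operator vector `M_n⁻¹ (0, …, 0, I)ᵀ`, on its natural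
domain: the set of all `y` for which `(0, …, 0, y)ᵀ` lies in the range of `M_n`. The inverse is
the genuine one as soon as `M_n` is injective. -/
noncomputable def coeffOp {r : ℕ} (n : ℕ) (B : Fin r → X →ₗ.[𝕜] X) (S : Fin r → ℕ)
    (p : Σ j : Fin r, Fin (S j)) : X →ₗ.[𝕜] X where
  domain := (opMatrix n B S).inverse.domain.comap (lastUnit 𝕜 X n)
  toFun := (LinearMap.proj p).comp ((opMatrix n B S).inverse.toFun.comp
    ((lastUnit 𝕜 X n).restrict fun _ hx => hx))

/-- `InRange C τ L g`, for an operator `C` and a list `L = [D₁, …, D_m]` of operators: the function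
`g ∈ C([0, τ]; X)` lies in the range of `C - D₁`, with a preimage `h` such that both `h` and
`C h` lie in turn in the range of `C - D₂` with such preimages, and so on up to `C - D_m`; all the
preimages that occur are continuous functions on `[0, τ]`. -/
def InRange (C : X →ₗ.[𝕜] X) (τ : ℝ) : List (X →ₗ.[𝕜] X) → (ℝ → X) → Prop
  | [], g => ContinuousOn g (Icc 0 τ)
  | D :: L, g => ContinuousOn g (Icc 0 τ) ∧ ∃ h Ch Dh : ℝ → X,
      (∀ s ∈ Icc 0 τ, (h s, Ch s) ∈ C.graph ∧ (h s, Dh s) ∈ D.graph ∧ Ch s - Dh s = g s) ∧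
      InRange C τ L h ∧ InRange C τ L Ch

/-- "The ranges of the `B_j - B_k` are large enough" (for the function `f`): for every `j`, the
function `f` can be divided successively by `B_j - B_{l_1}, …, B_j - B_{l_{n-1}}` in the sense of
`InRange`, for every sequence `l_1, …, l_{n-1}` of indices different from `j` in which each index
`l ≠ j` occurs at least `S_l` times. -/
def RangesLargeEnough {r : ℕ} (n : ℕ) (B : Fin r → X →ₗ.[𝕜] X) (S : Fin r → ℕ) (τ : ℝ)
    (f : ℝ → X) : Prop :=
  ∀ (j : Fin r) (L : List (Fin r)), j ∉ L → L.length = n - 1 → (∀ l, l ≠ j → S l ≤ L.count l) →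
    InRange (B j) τ (L.map B) f

/-- `u` solves the factored equation `∏_{a=1}^n (d/dt - A_a) u = f` on `[0, τ]`, and
`v_a = ∏_{b<a} (d/dt - A_b) u` are the intermediate functions: `v_0 = u`,
`v_{a+1} = v_a' - A_a v_a`, `v_n = f`, where each `v_a` (`a < n`) is continuously differentiable
on `[0, τ]` (one-sided at the end points) with values in `D(A_a)`. -/
structure IsFactoredSolution [NormedSpace ℝ X] {n : ℕ} (A : Fin n → X →ₗ.[𝕜] X) (τ : ℝ)
    (f u : ℝ → X) (v : Fin (n + 1) → ℝ → X) : Prop where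
  start : EqOn (v 0) u (Icc 0 τ)
  finish : EqOn (v (Fin.last n)) f (Icc 0 τ)
  contDiffOn : ∀ a : Fin n, ContDiffOn ℝ 1 (v a.castSucc) (Icc 0 τ)
  step : ∀ a : Fin n, ∀ t ∈ Icc 0 τ,
    (v a.castSucc t, derivWithin (v a.castSucc) (Icc 0 τ) t - v a.succ t) ∈ (A a).graph

/-- `u` solves the factored equation with zero initial data, in the form
`v_a(0) = 0` (`a = 0, …, n - 1`) for the first-order system satisfied by the intermediate
functions. -/
def IsZeroDataSolution [NormedSpace ℝ X] {n : ℕ} (A : Fin n → X →ₗ.[𝕜] X) (τ : ℝ)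
    (f u : ℝ → X) : Prop :=
  ∃ v : Fin (n + 1) → ℝ → X, IsFactoredSolution A τ f u v ∧ ∀ a : Fin n, v a.castSucc 0 = 0

/-- `u` has the initial data `u^(k)(0) = 0`, `k = 0, …, n - 1`, in the literal sense. -/
def HasZeroDerivs [NormedSpace ℝ X] (n : ℕ) (τ : ℝ) (u : ℝ → X) : Prop :=
  ContDiffOn ℝ ((n - 1 : ℕ) : WithTop ℕ∞) u (Icc 0 τ) ∧
    ∀ k < n, iteratedDerivWithin k u (Icc 0 τ) 0 = 0

/-- `∑_j ∑_{k<S_j} ∫_0^t ((t - s)^k / k!) T_{B_j}(t - s) z_{j,k}(s) ds`. -/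
noncomputable def dAlembert [NormedSpace ℝ X] {r : ℕ} (T : Fin r → C0Semigroup 𝕜 X)
    (S : Fin r → ℕ) (z : (Σ j : Fin r, Fin (S j)) → ℝ → X) (t : ℝ) : X :=
  ∑ j : Fin r, ∑ k : Fin (S j), ∫ s in (0 : ℝ)..t,
    ((t - s) ^ (k : ℕ) / ((k : ℕ).factorial : ℝ)) • (T j).op (t - s).toNNReal (z ⟨j, k⟩ s)

end Operators

/-! On $C([0,\tau];X)$ the primitive $J$ vanishing at $0$ and the pointwise resolvents
$P_j=(\lambda-B_j)^{-1}$ (a common large real $\lambda$) commute. They generate a commutative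
algebra, and the function space embeds into its localization at the injective elements of that
algebra (`exists_injective_localizedModule`). There $x=J^{-1}$ is the symbol of $d/dt$ with zero
initial value and $b_j=\lambda-P_j^{-1}$ that of $B_j$. Injectivity of $B_j-B_l$ makes $b_j-b_l$ a
unit, and uniqueness of mild solutions makes $x-b_j$ a unit (`exists_symbolCalculus`). Unbounded
operators have become elements of a commutative ring, and domain questions become membership in the
range of the embedding.

The rest is partial fractions. Confluent Hermite interpolation (`exists_hermite_basis`) inverts the
symbol matrix of $M_n$, and the last column $c$ of the inverse consists of the partial fraction
coefficients of $\prod_j(x-b_j)^{-S_j}$. Each $c_{j,k}$ is an integral combination of products of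
the $(b_j-b_l)^{-1}$ in which every $l\ne j$ occurs at least $S_l$ times, so the range hypothesis
says that $c_{j,k}f$, and its images under the required powers of $b_j$, are genuine continuous
functions (`exists_coefficients`). Convolution with $t^k/k!\,T_{B_j}(t)$ is multiplication by
$(x-b_j)^{-(k+1)}$ (`x_sub_pow_smul_convC`), so the formula gives the function $U$ with
$\prod_j(x-b_j)^{S_j}U=f$.

A solution with zero data satisfies the same identity, hence equals $U$. Since $f$ is $C^1$, solving
one factor after another produces a solution (`exists_solution_chain`), so $U$ is one. The two forms
of the initial data are compared after smoothing the intermediate functions by products of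
resolvents (`iteratedDerivWithin_eq_zero_iff`). -/

namespace C0Semigroup

/-! ### Strong continuity, generators and orbit integrals. -/

section Analysis

variable {𝕜 X : Type*} [RCLike 𝕜] [NormedAddCommGroup X] [NormedSpace 𝕜 X]

theorem op_comm (T : C0Semigroup 𝕜 X) (s t : ℝ≥0) (x : X) : T.op s (T.op t x) = T.op t (T.op s x) := by
  have h (a b : ℝ≥0) : T.op a (T.op b x) = T.op (a + b) x := by rw [T.op_add]; rfl
  rw [h, h, add_comm]

theorem exists_norm_op_le [CompleteSpace X] (T : C0Semigroup 𝕜 X) (a : ℝ≥0) :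
    ∃ C : ℝ, ∀ t ≤ a, ‖T.op t‖ ≤ C := by
  obtain ⟨C, hC⟩ := banach_steinhaus (g := fun t : Set.Iic a => T.op t) fun x => by
    have hc : IsCompact (Icc 0 a) := isCompact_Icc
    obtain ⟨C, hC⟩ := hc.exists_bound_of_continuousOn (T.continuous_op x).continuousOn
    exact ⟨C, fun t => hC t ⟨zero_le, t.2⟩⟩
  exact ⟨C, fun t ht => hC ⟨t, ht⟩⟩

theorem continuous_op_uncurry [CompleteSpace X] (T : C0Semigroup 𝕜 X) :
    Continuous fun p : ℝ≥0 × X => T.op p.1 p.2 := by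
  refine continuous_iff_continuousAt.2 fun ⟨t, x⟩ => ?_
  obtain ⟨C, hC⟩ := T.exists_norm_op_le (t + 1)
  have h1 : Tendsto (fun p : ℝ≥0 × X => T.op p.1 (p.2 - x)) (𝓝 (t, x)) (𝓝 0) := by
    have hb : Tendsto (fun p : ℝ≥0 × X => C * ‖p.2 - x‖) (𝓝 (t, x)) (𝓝 0) := by
      have : Continuous fun p : ℝ≥0 × X => C * ‖p.2 - x‖ := by fun_prop
      simpa using this.tendsto (t, x)
    refine squeeze_zero_norm' ?_ hb
    have : ∀ᶠ p : ℝ≥0 × X in 𝓝 (t, x), p.1 < t + 1 :=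
      continuous_fst.continuousAt.eventually (gt_mem_nhds (lt_add_one t))
    filter_upwards [this] with p hp
    exact ((T.op p.1).le_opNorm _).trans (by gcongr; exact hC _ hp.le)
  have h2 : Tendsto (fun p : ℝ≥0 × X => T.op p.1 x) (𝓝 (t, x)) (𝓝 (T.op t x)) :=
    ((T.continuous_op x).comp continuous_fst).tendsto (t, x)
  have h3 := h1.add h2
  rw [zero_add] at h3
  refine h3.congr fun p => ?_
  rw [← map_add, sub_add_cancel]

variable [NormedSpace ℝ X]

theorem HasGen.unique {T : C0Semigroup 𝕜 X} {x y y' : X} (h : T.HasGen x y) (h' : T.HasGen x y') :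
    y = y' :=
  tendsto_nhds_unique h h'

/-- A bounded operator that commutes with the semigroup commutes with its generator. -/
theorem HasGen.map {T : C0Semigroup 𝕜 X} {x y : X} (h : T.HasGen x y) (P : X →L[ℝ] X)
    (hP : ∀ t z, T.op t (P z) = P (T.op t z)) : T.HasGen (P x) (P y) := by
  refine ((P.continuous.tendsto y).comp h).congr fun t => ?_
  simp [hP]

variable [IsScalarTower ℝ 𝕜 X]

/-- The operator at time `max t 0`, as a real-linear operator. -/
def realOp (T : C0Semigroup 𝕜 X) (t : ℝ) : X →L[ℝ] X := (T.op t.toNNReal).restrictScalars ℝ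

theorem realOp_apply (T : C0Semigroup 𝕜 X) (t : ℝ) (x : X) :
    T.realOp t x = T.op t.toNNReal x := rfl

theorem realOp_zero (T : C0Semigroup 𝕜 X) (x : X) : T.realOp 0 x = x := by
  simp [realOp_apply, T.op_zero]

theorem realOp_add (T : C0Semigroup 𝕜 X) {s t : ℝ} (hs : 0 ≤ s) (ht : 0 ≤ t) (x : X) :
    T.realOp (s + t) x = T.realOp s (T.realOp t x) := by
  simp only [realOp_apply, Real.toNNReal_add hs ht, T.op_add]
  rfl

theorem continuous_realOp [CompleteSpace X] (T : C0Semigroup 𝕜 X) {α : Type*} [TopologicalSpace α]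
    {t : α → ℝ} {x : α → X} (ht : Continuous t) (hx : Continuous x) :
    Continuous fun a => T.realOp (t a) (x a) :=
  T.continuous_op_uncurry.comp ((continuous_real_toNNReal.comp ht).prodMk hx)

theorem HasGen.tendsto_realOp {T : C0Semigroup 𝕜 X} {x y : X} (h : T.HasGen x y) :
    Tendsto (fun h : ℝ => h⁻¹ • (T.realOp h x - x)) (𝓝[>] 0) (𝓝 y) := h

/-- The right derivative follows at once from the semigroup law, and it suffices for the fundamental
theorem of calculus in the form used below. -/
theorem HasGen.hasDerivWithinAt {T : C0Semigroup 𝕜 X} {x y : X} (h : T.HasGen x y) {t : ℝ}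
    (ht : 0 ≤ t) : HasDerivWithinAt (fun s => T.realOp s x) (T.realOp t y) (Ioi t) t := by
  rw [hasDerivWithinAt_iff_tendsto_slope' (by simp)]
  have h1 := ((T.realOp t).continuous.tendsto y).comp h.tendsto_realOp
  have h2 : Tendsto (fun s => s - t) (𝓝[>] t) (𝓝[>] 0) := by
    refine tendsto_nhdsWithin_iff.2 ⟨?_, eventually_mem_nhdsWithin.mono fun s hs => sub_pos.2 (mem_Ioi.1 hs)⟩
    have : Continuous fun s : ℝ => s - t := by fun_prop
    simpa using (this.tendsto t).mono_left nhdsWithin_le_nhds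
  refine (h1.comp h2).congr' ?_
  filter_upwards [self_mem_nhdsWithin] with s hs
  have hs' : 0 ≤ s - t := (sub_pos.2 (mem_Ioi.1 hs)).le
  simp only [Function.comp_apply, map_smul, map_sub, slope, vsub_eq_sub]
  rw [← T.realOp_add ht hs', add_sub_cancel]

variable [CompleteSpace X]

/-- The integral of the damped orbit. -/
noncomputable def dampedIntegral (T : C0Semigroup 𝕜 X) (lam a : ℝ) (x : X) : X :=
  ∫ s in (0 : ℝ)..a, Real.exp (-(lam * s)) • T.realOp s x

theorem continuous_damped (T : C0Semigroup 𝕜 X) (lam : ℝ) (x : X) :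
    Continuous fun s : ℝ => Real.exp (-(lam * s)) • T.realOp s x :=
  (by fun_prop : Continuous fun s : ℝ => Real.exp (-(lam * s))).smul
    (T.continuous_realOp continuous_id continuous_const)

/-- Integrates the derivative of $e^{-\lambda s}T(s)x$. A truncated Laplace transform replaces the
full one, so no growth bound or improper integral is needed; the price is the boundary term at $a$.
-/
theorem dampedIntegral_gen (T : C0Semigroup 𝕜 X) (lam : ℝ) {a : ℝ} (ha : 0 ≤ a) {x y : X}
    (h : T.HasGen x y) :
    T.dampedIntegral lam a (lam • x - y) = x - Real.exp (-(lam * a)) • T.realOp a x := by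
  have key : ∫ s in (0 : ℝ)..a, Real.exp (-(lam * s)) • T.realOp s (y - lam • x) =
      Real.exp (-(lam * a)) • T.realOp a x - Real.exp (-(lam * 0)) • T.realOp 0 x := by
    refine intervalIntegral.integral_eq_sub_of_hasDeriv_right
      (T.continuous_damped lam x).continuousOn (fun s hs => ?_)
      ((T.continuous_damped lam _).intervalIntegrable _ _)
    rw [min_eq_left ha] at hs
    have h1 : HasDerivWithinAt (fun s => Real.exp (-(lam * s))) (Real.exp (-(lam * s)) * -lam)
        (Ioi s) s := by
      have := ((hasDerivAt_id s).const_mul lam).neg.exp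
      simpa using this.hasDerivWithinAt
    refine (h1.smul (h.hasDerivWithinAt hs.1.le)).congr_deriv ?_
    rw [map_sub, map_smul, smul_sub, mul_smul, neg_smul, smul_neg]
    abel
  simp only [mul_zero, neg_zero, Real.exp_zero, one_smul, realOp_zero] at key
  rw [← neg_inj, neg_sub, ← key, dampedIntegral, ← intervalIntegral.integral_neg]
  refine intervalIntegral.integral_congr fun s _ => ?_
  simp only [← smul_neg, ← map_neg, neg_sub]

/-- Applying $T(h)$ to the integral shifts its limits to $[h,a+h]$ and multiplies it by $e^{\lambda
h}$; the generator is the derivative of the resulting expression at $h=0$. -/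
theorem hasGen_dampedIntegral (T : C0Semigroup 𝕜 X) (lam : ℝ) {a : ℝ} (ha : 0 ≤ a) (x : X) :
    T.HasGen (T.dampedIntegral lam a x)
      (lam • T.dampedIntegral lam a x - (x - Real.exp (-(lam * a)) • T.realOp a x)) := by
  have hc := T.continuous_damped lam x
  have hd : HasDerivAt (fun h : ℝ => Real.exp (lam * h) •
      ((∫ s in (0 : ℝ)..(a + h), Real.exp (-(lam * s)) • T.realOp s x) -
        ∫ s in (0 : ℝ)..h, Real.exp (-(lam * s)) • T.realOp s x))
      (lam • T.dampedIntegral lam a x - (x - Real.exp (-(lam * a)) • T.realOp a x)) 0 := by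
    have h1 : HasDerivAt (fun h : ℝ => Real.exp (lam * h)) lam 0 := by
      simpa using ((hasDerivAt_id (0 : ℝ)).const_mul lam).exp
    have h2 : HasDerivAt (fun h : ℝ => ∫ s in (0 : ℝ)..h, Real.exp (-(lam * s)) • T.realOp s x)
        x 0 := by
      simpa [realOp_zero] using hc.integral_hasStrictDerivAt 0 0 |>.hasDerivAt
    have h3 : HasDerivAt
        (fun h : ℝ => ∫ s in (0 : ℝ)..(a + h), Real.exp (-(lam * s)) • T.realOp s x)
        (Real.exp (-(lam * a)) • T.realOp a x) 0 := by
      have := (hc.integral_hasStrictDerivAt 0 (a + 0)).hasDerivAt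
      have := this.comp_const_add a 0
      simpa using this
    refine (h1.smul (h3.sub h2)).congr_deriv ?_
    simp [dampedIntegral]
    abel
  have := hd.tendsto_slope_zero_right
  refine this.congr' ?_
  filter_upwards [self_mem_nhdsWithin] with h hh
  replace hh : 0 < h := hh
  have hi : ∀ u v, IntervalIntegrable (fun s : ℝ => Real.exp (-(lam * s)) • T.realOp s x)
    MeasureTheory.volume u v := fun u v => hc.intervalIntegrable u v
  congr 2
  · rw [zero_add, intervalIntegral.integral_interval_sub_left (hi _ _) (hi _ _), ← realOp_apply,
      dampedIntegral, ← ContinuousLinearMap.intervalIntegral_comp_comm _ (hi _ _),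
      ← intervalIntegral.integral_smul]
    have := intervalIntegral.integral_comp_add_right (a := 0) (b := a)
      (fun s => Real.exp (lam * h) • Real.exp (-(lam * s)) • T.realOp s x) h
    rw [zero_add] at this
    rw [← this]
    refine intervalIntegral.integral_congr fun s hs => ?_
    rw [uIcc_of_le ha] at hs
    simp only [map_smul]
    rw [add_comm s h, T.realOp_add hh.le hs.1, smul_smul, ← Real.exp_add]
    congr 2
    ring
  · simp [dampedIntegral]

theorem hasGen_integral (T : C0Semigroup 𝕜 X) {a : ℝ} (ha : 0 ≤ a) (x : X) :
    T.HasGen (∫ s in (0 : ℝ)..a, T.realOp s x) (T.realOp a x - x) := by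
  simpa [dampedIntegral] using T.hasGen_dampedIntegral 0 ha x

end Analysis

end C0Semigroup

/-- Fubini on the square for the kernel extended by zero off the triangle. -/
theorem intervalIntegral_triangle_swap {E : Type*} [NormedAddCommGroup E] [NormedSpace ℝ E]
    [CompleteSpace E] {G : ℝ → ℝ → E} (hG : Continuous (Function.uncurry G)) {t : ℝ} (ht : 0 ≤ t) :
    ∫ σ in (0 : ℝ)..t, ∫ s in (0 : ℝ)..σ, G σ s = ∫ s in (0 : ℝ)..t, ∫ σ in s..t, G σ s := by
  let F : ℝ → ℝ → E := fun σ s => if s ≤ σ then G σ s else 0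
  have hc1 : ∀ σ, Continuous (G σ) := fun σ => hG.comp (Continuous.prodMk_right σ)
  have hc2 : ∀ s, Continuous fun σ => G σ s := fun s => hG.comp (Continuous.prodMk_left s)
  have hF : MeasureTheory.IntegrableOn (Function.uncurry F) (uIoc 0 t ×ˢ uIoc 0 t) := by
    have h1 : MeasureTheory.IntegrableOn (Function.uncurry G) (uIoc 0 t ×ˢ uIoc 0 t) :=
      (hG.continuousOn.integrableOn_compact (isCompact_Icc.prod isCompact_Icc)).mono_set
        (prod_mono uIoc_subset_uIcc uIoc_subset_uIcc)
    have h2 : MeasurableSet {p : ℝ × ℝ | p.2 ≤ p.1} := measurableSet_le measurable_snd measurable_fst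
    have h3 := MeasureTheory.IntegrableOn.indicator h1 h2
    refine h3.congr_fun (fun p _ => ?_) (measurableSet_uIoc.prod measurableSet_uIoc)
    simp only [indicator, Function.uncurry, F, mem_ofPred_eq]
  have hF1 : ∀ σ ∈ Icc 0 t, ∫ s in (0 : ℝ)..t, F σ s = ∫ s in (0 : ℝ)..σ, G σ s := by
    intro σ hσ
    have e1 : ∀ s ∈ uIoc 0 σ, G σ s = F σ s := fun s hs => by
      rw [uIoc_of_le hσ.1] at hs
      simp [F, hs.2]
    have e2 : ∀ s ∈ uIoc σ t, (0 : E) = F σ s := fun s hs => by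
      rw [uIoc_of_le hσ.2] at hs
      simp [F, not_le.2 hs.1]
    have i1 : IntervalIntegrable (F σ) MeasureTheory.volume 0 σ :=
      ((hc1 σ).intervalIntegrable 0 σ).congr e1
    have i2 : IntervalIntegrable (F σ) MeasureTheory.volume σ t :=
      (intervalIntegrable_const (c := (0 : E))).congr e2
    rw [← intervalIntegral.integral_add_adjacent_intervals i1 i2,
      ← intervalIntegral.integral_congr_ae (.of_forall e1), ← intervalIntegral.integral_congr_ae (.of_forall e2)]
    simp
  have hF2 : ∀ s ∈ Icc 0 t, ∫ σ in (0 : ℝ)..t, F σ s = ∫ σ in s..t, G σ s := by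
    intro s hs
    have e1 : ∀ᵐ σ, σ ∈ uIoc 0 s → (0 : E) = F σ s := by
      have : ∀ᵐ σ : ℝ, σ ≠ s := by simp [MeasureTheory.ae_iff]
      filter_upwards [this] with σ hσ h
      rw [uIoc_of_le hs.1] at h
      simp [F, not_le.2 (lt_of_le_of_ne h.2 hσ)]
    have e2 : ∀ σ ∈ uIoc s t, G σ s = F σ s := fun σ h => by
      rw [uIoc_of_le hs.2] at h
      simp [F, h.1.le]
    have i1 : IntervalIntegrable (fun σ => F σ s) MeasureTheory.volume 0 s :=
      (intervalIntegrable_const (c := (0 : E))).congr_ae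
        ((MeasureTheory.ae_restrict_iff' measurableSet_uIoc).2 e1)
    have i2 : IntervalIntegrable (fun σ => F σ s) MeasureTheory.volume s t :=
      ((hc2 s).intervalIntegrable s t).congr e2
    rw [← intervalIntegral.integral_add_adjacent_intervals i1 i2,
      ← intervalIntegral.integral_congr_ae e1, ← intervalIntegral.integral_congr_ae (.of_forall e2)]
    simp
  calc _ = ∫ σ in (0 : ℝ)..t, ∫ s in (0 : ℝ)..t, F σ s :=
        intervalIntegral.integral_congr fun σ hσ => (hF1 σ (by rwa [uIcc_of_le ht] at hσ)).symm
    _ = ∫ s in (0 : ℝ)..t, ∫ σ in (0 : ℝ)..t, F σ s :=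
        MeasureTheory.intervalIntegral_intervalIntegral_swap hF
    _ = _ := intervalIntegral.integral_congr fun s hs => hF2 s (by rwa [uIcc_of_le ht] at hs)

namespace C0Semigroup

/-! ### Resolvents, mild solutions and convolutions. -/

section Resolvent

variable {𝕜 X : Type*} [RCLike 𝕜] [NormedAddCommGroup X] [NormedSpace 𝕜 X] [NormedSpace ℝ X]

/-- `R` is the resolvent `(lam - B)⁻¹` of the generator `B` of the semigroup. -/
def IsResolvent (T : C0Semigroup 𝕜 X) (lam : ℝ) (R : X →L[ℝ] X) : Prop :=
  ∀ x y, T.HasGen x y ↔ R (lam • x - y) = x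

theorem IsResolvent.hasGen {T : C0Semigroup 𝕜 X} {lam : ℝ} {R : X →L[ℝ] X}
    (hR : T.IsResolvent lam R) (w : X) : T.HasGen (R w) (lam • R w - w) :=
  (hR _ _).2 (by rw [sub_sub_cancel])

theorem IsResolvent.comm {T : C0Semigroup 𝕜 X} {lam : ℝ} {R : X →L[ℝ] X}
    (hR : T.IsResolvent lam R) (P : X →L[ℝ] X) (hP : ∀ t z, T.op t (P z) = P (T.op t z)) (w : X) :
    R (P w) = P (R w) := by
  have := (hR _ _).1 ((hR.hasGen w).map P hP)
  rwa [← map_smul, ← map_sub, sub_sub_cancel] at this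

theorem IsResolvent.injective {T : C0Semigroup 𝕜 X} {lam : ℝ} {R : X →L[ℝ] X}
    (hR : T.IsResolvent lam R) : Function.Injective R := by
  refine (injective_iff_map_eq_zero R).2 fun w hw => ?_
  have := hR.hasGen w
  rw [hw, smul_zero, zero_sub] at this
  exact neg_eq_zero.1 (this.unique (HasGen.zero T))

variable [IsScalarTower ℝ 𝕜 X]

/-- Two applications of `IsResolvent.comm`: `R'` commutes with the operators of `T`, and therefore
with the resolvent of `T`. -/
theorem IsResolvent.comm_of_comm {T T' : C0Semigroup 𝕜 X} {lam : ℝ} {R R' : X →L[ℝ] X}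
    (hR : T.IsResolvent lam R) (hR' : T'.IsResolvent lam R')
    (h : ∀ s t, (T.op s).comp (T'.op t) = (T'.op t).comp (T.op s)) (w : X) :
    R (R' w) = R' (R w) := by
  refine hR.comm R' (fun t z => ?_) w
  have := hR'.comm (T.realOp t) (fun s z => ?_) z
  · rw [realOp_apply, realOp_apply, Real.toNNReal_coe] at this
    exact this.symm
  · rw [realOp_apply, realOp_apply, Real.toNNReal_coe]
    exact (DFunLike.congr_fun (h t s) z).symm

variable [CompleteSpace X]

/-- The damped integral $V$ over $[0,1]$ inverts $\lambda-B$ up to $E=1-e^{-\lambda}T(1)$. For large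
$\lambda$ a Neumann series inverts $E$, which commutes with $V$, and the resolvent is $E^{-1}V$.
Having all large $\lambda$ allows a common one for finitely many semigroups. -/
theorem eventually_exists_isResolvent (T : C0Semigroup 𝕜 X) :
    ∀ᶠ lam : ℝ in atTop, ∃ R : X →L[ℝ] X, T.IsResolvent lam R := by
  have hlim : Tendsto (fun lam : ℝ => Real.exp (-lam) * ‖T.realOp 1‖) atTop (𝓝 0) := by
    simpa using (Real.tendsto_exp_neg_atTop_nhds_zero).mul_const ‖T.realOp 1‖
  filter_upwards [hlim.eventually (gt_mem_nhds one_pos), eventually_ge_atTop 0] with lam hlam h0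
  obtain ⟨C, hC⟩ := T.exists_norm_op_le 1
  have hi : ∀ x, IntervalIntegrable (fun s : ℝ => Real.exp (-(lam * s)) • T.realOp s x)
    MeasureTheory.volume 0 1 := fun x => (T.continuous_damped lam x).intervalIntegrable _ _
  let V : X →L[ℝ] X := LinearMap.mkContinuous
    { toFun := T.dampedIntegral lam 1
      map_add' := fun x y => by
        simp only [dampedIntegral, map_add, smul_add]
        exact intervalIntegral.integral_add (hi x) (hi y)
      map_smul' := fun c x => by
        simp only [dampedIntegral, map_smul, RingHom.id_apply]
        rw [← intervalIntegral.integral_smul]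
        simp only [smul_comm c] } C fun x => by
      have := intervalIntegral.norm_integral_le_of_norm_le_const (a := 0) (b := 1)
        (f := fun s : ℝ => Real.exp (-(lam * s)) • T.realOp s x) (C := C * ‖x‖) fun s hs => by
          rw [uIoc_of_le zero_le_one] at hs
          rw [norm_smul, Real.norm_eq_abs, Real.abs_exp]
          calc Real.exp (-(lam * s)) * ‖T.realOp s x‖ ≤ 1 * ‖T.realOp s x‖ := by
                gcongr
                exact Real.exp_le_one_iff.2 (neg_nonpos.2 (mul_nonneg h0 hs.1.le))
            _ ≤ C * ‖x‖ := by
                rw [one_mul]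
                refine ((T.op s.toNNReal).le_opNorm x).trans ?_
                gcongr
                exact hC _ (by simpa using hs.2)
      simpa [dampedIntegral] using this
  have hVdef : ∀ x, V x = T.dampedIntegral lam 1 x := fun _ => rfl
  let E : X →L[ℝ] X := 1 - Real.exp (-lam) • T.realOp 1
  have hEdef : ∀ x, E x = x - Real.exp (-(lam * 1)) • T.realOp 1 x := fun x => by simp [E]
  obtain ⟨u, hu⟩ : IsUnit E := isUnit_one_sub_of_norm_lt_one (by
    rw [norm_smul, Real.norm_eq_abs, Real.abs_exp]
    exact hlam)
  have hEi : ∀ x, E ((↑u⁻¹ : X →L[ℝ] X) x) = x := fun x => by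
    rw [← hu, ← mul_apply_eq_comp, u.mul_inv, one_apply_eq_self]
  have hiE : ∀ x, (↑u⁻¹ : X →L[ℝ] X) (E x) = x := fun x => by
    rw [← hu, ← mul_apply_eq_comp, u.inv_mul, one_apply_eq_self]
  have hVE : ∀ x, V (E x) = E (V x) := fun x => by
    have : V (T.realOp 1 x) = T.realOp 1 (V x) := by
      rw [hVdef, hVdef, dampedIntegral, dampedIntegral,
        ← ContinuousLinearMap.intervalIntegral_comp_comm _ (hi x)]
      refine intervalIntegral.integral_congr fun s _ => ?_
      simp only [map_smul]
      congr 1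
      exact T.op_comm _ _ _
    rw [hEdef, hEdef, map_sub, map_smul, this]
  refine ⟨(↑u⁻¹ : X →L[ℝ] X) * V, fun x y => ⟨fun h => ?_, fun h => ?_⟩⟩
  · rw [mul_apply_eq_comp, hVdef, T.dampedIntegral_gen lam zero_le_one h, ← hEdef, hiE]
  · set w := lam • x - y with hw
    have hx : x = V ((↑u⁻¹ : X →L[ℝ] X) w) := by
      rw [← h, mul_apply_eq_comp, ← hiE (V ((↑u⁻¹ : X →L[ℝ] X) w)), ← hVE, hEi]
    have := T.hasGen_dampedIntegral lam zero_le_one ((↑u⁻¹ : X →L[ℝ] X) w)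
    rw [← hVdef, ← hEdef, hEi, ← hx, hw, sub_sub_cancel] at this
    exact this

/-- A mild solution of `w' = B w` with `w 0 = 0` vanishes. -/
theorem eq_zero_of_hasGen_integral (T : C0Semigroup 𝕜 X) {τ : ℝ} {w : ℝ → X} (hw : Continuous w)
    (h : ∀ t ∈ Icc 0 τ, T.HasGen (∫ s in (0 : ℝ)..t, w s) (w t)) {t : ℝ} (ht : t ∈ Icc 0 τ) :
    ∫ s in (0 : ℝ)..t, w s = 0 := by
  set p : ℝ → X := fun t => ∫ s in (0 : ℝ)..t, w s with hp
  have hpd : ∀ s, HasDerivAt p (w s) s := fun s => (hw.integral_hasStrictDerivAt 0 s).hasDerivAt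
  have hpc : Continuous p := continuous_iff_continuousAt.2 fun s => (hpd s).continuousAt
  -- Since $p'=w=Bp$, the right difference quotient of $T(t-s)p(s)$ is $T(t-s')$ applied to a
  -- difference of two quotients with the same limit $w(s)$. The function is thus constant, with
  -- value $p(t)$ at $s=t$ and $0$ at $s=0$.
  have key := constant_of_has_deriv_right_zero (a := 0) (b := t)
    (f := fun s => T.realOp (t - s) (p s))
    (T.continuous_realOp (continuous_const.sub continuous_id) hpc).continuousOn (fun s hs => by
      rw [← hasDerivWithinAt_Ioi_iff_Ici, hasDerivWithinAt_iff_tendsto_slope' (by simp)]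
      have hs0 : Tendsto (fun s' => s' - s) (𝓝[>] s) (𝓝[>] 0) := by
        refine tendsto_nhdsWithin_iff.2
          ⟨?_, eventually_mem_nhdsWithin.mono fun s' hs => sub_pos.2 (mem_Ioi.1 hs)⟩
        have : Continuous fun s' : ℝ => s' - s := by fun_prop
        simpa using (this.tendsto s).mono_left nhdsWithin_le_nhds
      have h1 : Tendsto (slope p s) (𝓝[>] s) (𝓝 (w s)) :=
        (hasDerivWithinAt_iff_tendsto_slope' (by simp)).1 (hpd s).hasDerivWithinAt
      have h2 := (h s ⟨hs.1, hs.2.le.trans ht.2⟩).tendsto_realOp.comp hs0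
      have h3 := h1.sub h2
      rw [sub_self] at h3
      have h4 : Tendsto (fun s' => t - s') (𝓝[>] s) (𝓝 (t - s)) := by
        have : Continuous fun s' : ℝ => t - s' := by fun_prop
        exact (this.tendsto s).mono_left nhdsWithin_le_nhds
      have h5 := ((T.continuous_realOp (continuous_fst (X := ℝ) (Y := X))
        continuous_snd).tendsto (t - s, 0)).comp (h4.prodMk_nhds h3)
      rw [map_zero] at h5
      refine h5.congr' ?_
      filter_upwards [Ioo_mem_nhdsGT hs.2] with s' hs'
      simp only [Function.comp_apply, slope, vsub_eq_sub]
      rw [← smul_sub, map_smul]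
      congr 1
      rw [sub_sub_sub_cancel_right, map_sub,
        ← T.realOp_add (sub_nonneg.2 hs'.2.le) (sub_nonneg.2 hs'.1.le), sub_add_sub_cancel]) t
    (right_mem_Icc.2 ht.1)
  simpa [realOp_zero, hp] using key

/-- The convolution of `t ↦ t ^ k / k! • T(t)` with `z`. -/
noncomputable def conv (T : C0Semigroup 𝕜 X) (k : ℕ) (z : ℝ → X) (t : ℝ) : X :=
  ∫ s in (0 : ℝ)..t, ((t - s) ^ k / (k.factorial : ℝ)) • T.realOp (t - s) (z s)

theorem continuous_convKernel (T : C0Semigroup 𝕜 X) (k : ℕ) {z : ℝ → X} (hz : Continuous z) :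
    Continuous (Function.uncurry fun t s : ℝ =>
      ((t - s) ^ k / (k.factorial : ℝ)) • T.realOp (t - s) (z s)) :=
  (by fun_prop : Continuous fun p : ℝ × ℝ => (p.1 - p.2) ^ k / (k.factorial : ℝ)).smul
    (T.continuous_realOp (continuous_fst.sub continuous_snd) (hz.comp continuous_snd))

theorem continuous_convKernel_right (T : C0Semigroup 𝕜 X) (k : ℕ) {z : ℝ → X} (hz : Continuous z)
    (t : ℝ) : Continuous fun s : ℝ => ((t - s) ^ k / (k.factorial : ℝ)) • T.realOp (t - s) (z s) :=
  (T.continuous_convKernel k hz).comp (Continuous.prodMk_right t)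

theorem continuous_conv (T : C0Semigroup 𝕜 X) (k : ℕ) {z : ℝ → X} (hz : Continuous z) :
    Continuous (T.conv k z) :=
  intervalIntegral.continuous_parametric_intervalIntegral_of_continuous
    (T.continuous_convKernel k hz) continuous_id

theorem IsResolvent.comm_conv {T : C0Semigroup 𝕜 X} {lam : ℝ} {R : X →L[ℝ] X}
    (hR : T.IsResolvent lam R) (k : ℕ) {z : ℝ → X} (hz : Continuous z) (t : ℝ) :
    R (T.conv k z t) = T.conv k (fun s => R (z s)) t := by
  rw [conv, conv, ← ContinuousLinearMap.intervalIntegral_comp_comm _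
    ((T.continuous_convKernel_right k hz t).intervalIntegrable _ _)]
  refine intervalIntegral.integral_congr fun s _ => ?_
  simp only [map_smul]
  congr 1
  exact hR.comm (T.realOp (t - s)) (fun a z => T.op_comm _ _ _) _

theorem integral_realOp_gen (T : C0Semigroup 𝕜 X) {x y : X} (h : T.HasGen x y) {a : ℝ}
    (ha : 0 ≤ a) : ∫ s in (0 : ℝ)..a, T.realOp s y = T.realOp a x - x := by
  have := T.dampedIntegral_gen 0 ha h
  simp only [dampedIntegral, zero_smul, zero_sub, map_neg, zero_mul, neg_zero, Real.exp_zero,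
    one_smul, intervalIntegral.integral_neg] at this
  rw [← neg_inj, this, neg_sub]

theorem integral_pow_smul_realOp_gen (T : C0Semigroup 𝕜 X) (k : ℕ) {x y : X} (h : T.HasGen x y)
    {a : ℝ} (ha : 0 ≤ a) :
    ∫ s in (0 : ℝ)..a, ((s ^ k / (k.factorial : ℝ)) • T.realOp s x +
      (s ^ (k + 1) / ((k + 1).factorial : ℝ)) • T.realOp s y) =
      (a ^ (k + 1) / ((k + 1).factorial : ℝ)) • T.realOp a x := by
  have hc : ∀ (m : ℕ) z, Continuous fun s : ℝ => (s ^ m / (m.factorial : ℝ)) • T.realOp s z :=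
    fun m z => (by fun_prop : Continuous fun s : ℝ => s ^ m / (m.factorial : ℝ)).smul
      (T.continuous_realOp continuous_id continuous_const)
  have hcc : Continuous fun s : ℝ => (s ^ k / (k.factorial : ℝ)) • T.realOp s x +
      (s ^ (k + 1) / ((k + 1).factorial : ℝ)) • T.realOp s y := (hc k x).add (hc (k + 1) y)
  rw [intervalIntegral.integral_eq_sub_of_hasDeriv_right (hc (k + 1) x).continuousOn
    (fun s hs => ?_) (hcc.intervalIntegrable _ _)]
  · simp
  · rw [min_eq_left ha] at hs
    have h1 : HasDerivWithinAt (fun s : ℝ => s ^ (k + 1) / ((k + 1).factorial : ℝ))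
        (s ^ k / (k.factorial : ℝ)) (Ioi s) s := by
      refine (((hasDerivAt_pow (k + 1) s).div_const _).congr_deriv ?_).hasDerivWithinAt
      rw [Nat.factorial_succ]
      have := Nat.factorial_ne_zero k
      push_cast
      field_simp
    exact (h1.smul (h.hasDerivWithinAt hs.1.le)).congr_deriv (add_comm _ _)

/-- As $z$ is only continuous, the identity is first proved for $Rz$, whose values lie in the
domain: after exchanging the integrals, the inner one is an orbit integral of $BRz=\lambda Rz-z$.
The characterization of the generator by $R$ then removes $R$. -/
theorem hasGen_integral_conv_zero (T : C0Semigroup 𝕜 X) {z : ℝ → X} (hz : Continuous z) {t : ℝ}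
    (ht : 0 ≤ t) :
    T.HasGen (∫ s in (0 : ℝ)..t, T.conv 0 z s) (T.conv 0 z t - ∫ s in (0 : ℝ)..t, z s) := by
  obtain ⟨lam, R, hR⟩ := T.eventually_exists_isResolvent.exists
  have hRz : Continuous fun s => R (z s) := R.continuous.comp hz
  have hv : Continuous fun s => lam • R (z s) - z s := (hRz.const_smul lam).sub hz
  have hint : ∀ {g : ℝ → X}, Continuous g → IntervalIntegrable g MeasureTheory.volume 0 t :=
    fun hg => hg.intervalIntegrable _ _
  have hsw := intervalIntegral_triangle_swap (G := fun t s => ((t - s) ^ 0 / ((0).factorial : ℝ)) •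
    T.realOp (t - s) (lam • R (z s) - z s)) (T.continuous_convKernel 0 hv) ht
  have hl : ∀ σ, ∫ s in (0 : ℝ)..σ, ((σ - s) ^ 0 / ((0).factorial : ℝ)) •
      T.realOp (σ - s) (lam • R (z s) - z s) = lam • R (T.conv 0 z σ) - T.conv 0 z σ := by
    intro σ
    rw [hR.comm_conv 0 hz]
    simp only [conv]
    rw [← intervalIntegral.integral_smul, ← intervalIntegral.integral_sub]
    · refine intervalIntegral.integral_congr fun s _ => ?_
      simp only [map_sub, map_smul, smul_sub, smul_comm lam]
    · exact ((T.continuous_convKernel_right 0 hRz σ).const_smul lam).intervalIntegrable _ _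
    · exact (T.continuous_convKernel_right 0 hz σ).intervalIntegrable _ _
  have hr : ∀ s ∈ uIcc 0 t, ∫ σ in s..t, ((σ - s) ^ 0 / ((0).factorial : ℝ)) •
      T.realOp (σ - s) (lam • R (z s) - z s) =
      ((t - s) ^ 0 / ((0).factorial : ℝ)) • T.realOp (t - s) (R (z s)) - R (z s) := by
    intro s hs
    rw [uIcc_of_le ht] at hs
    have h1 := T.integral_realOp_gen (hR.hasGen (z s)) (sub_nonneg.2 hs.2)
    have h2 := intervalIntegral.integral_comp_sub_right (a := s) (b := t)
      (fun σ => T.realOp σ (lam • R (z s) - z s)) s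
    rw [sub_self, h1] at h2
    simpa using h2
  simp only [hl] at hsw
  have hck := T.continuous_conv 0 hz
  have hRc : Continuous fun σ => R (T.conv 0 z σ) := R.continuous.comp hck
  have hlRc : Continuous fun σ => lam • R (T.conv 0 z σ) := hRc.const_smul lam
  rw [intervalIntegral.integral_congr hr, intervalIntegral.integral_sub (hint hlRc) (hint hck),
    intervalIntegral.integral_sub (hint (T.continuous_convKernel_right 0 hRz t)) (hint hRz),
    intervalIntegral.integral_smul, ContinuousLinearMap.intervalIntegral_comp_comm R (hint hck),
    ContinuousLinearMap.intervalIntegral_comp_comm R (hint hz)] at hsw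
  change _ = T.conv 0 (fun s => R (z s)) t - _ at hsw
  rw [← hR.comm_conv 0 hz] at hsw
  rw [hR, map_sub, map_sub, map_smul, sub_sub_eq_add_sub, add_sub_right_comm, ← sub_eq_zero]
  rw [← sub_eq_zero] at hsw
  rw [← hsw]
  abel

/-- The same method, with the derivative of $s^{k+1}/(k+1)!\,T(s)x$ contributing the extra term of
order $k$: in integrated form, $d/dt-B$ lowers the order of the kernel by one. -/
theorem hasGen_integral_conv_succ (T : C0Semigroup 𝕜 X) (k : ℕ) {z : ℝ → X} (hz : Continuous z)
    {t : ℝ} (ht : 0 ≤ t) :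
    T.HasGen (∫ s in (0 : ℝ)..t, T.conv (k + 1) z s)
      (T.conv (k + 1) z t - ∫ s in (0 : ℝ)..t, T.conv k z s) := by
  obtain ⟨lam, R, hR⟩ := T.eventually_exists_isResolvent.exists
  have hRz : Continuous fun s => R (z s) := R.continuous.comp hz
  have hv : Continuous fun s => lam • R (z s) - z s := (hRz.const_smul lam).sub hz
  have hint : ∀ {g : ℝ → X}, Continuous g → IntervalIntegrable g MeasureTheory.volume 0 t :=
    fun hg => hg.intervalIntegrable _ _
  have hsw := intervalIntegral_triangle_swap (G := fun t s =>
    ((t - s) ^ k / (k.factorial : ℝ)) • T.realOp (t - s) (R (z s)) +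
    ((t - s) ^ (k + 1) / ((k + 1).factorial : ℝ)) • T.realOp (t - s) (lam • R (z s) - z s))
    ((T.continuous_convKernel k hRz).add (T.continuous_convKernel (k + 1) hv)) ht
  have hl : ∀ σ, ∫ s in (0 : ℝ)..σ, (((σ - s) ^ k / (k.factorial : ℝ)) •
      T.realOp (σ - s) (R (z s)) + ((σ - s) ^ (k + 1) / ((k + 1).factorial : ℝ)) •
      T.realOp (σ - s) (lam • R (z s) - z s)) =
      R (T.conv k z σ) + (lam • R (T.conv (k + 1) z σ) - T.conv (k + 1) z σ) := by
    intro σ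
    rw [hR.comm_conv k hz, hR.comm_conv (k + 1) hz]
    simp only [conv]
    rw [← intervalIntegral.integral_smul, ← intervalIntegral.integral_sub,
      ← intervalIntegral.integral_add]
    · refine intervalIntegral.integral_congr fun s _ => ?_
      simp only [map_sub, map_smul, smul_sub, smul_comm lam]
    · exact (T.continuous_convKernel_right k hRz σ).intervalIntegrable _ _
    · exact (((T.continuous_convKernel_right (k + 1) hRz σ).const_smul lam).sub (T.continuous_convKernel_right (k + 1) hz σ)).intervalIntegrable _ _
    · exact ((T.continuous_convKernel_right (k + 1) hRz σ).const_smul lam).intervalIntegrable _ _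
    · exact (T.continuous_convKernel_right (k + 1) hz σ).intervalIntegrable _ _
  have hr : ∀ s ∈ uIcc 0 t, ∫ σ in s..t, (((σ - s) ^ k / (k.factorial : ℝ)) •
      T.realOp (σ - s) (R (z s)) + ((σ - s) ^ (k + 1) / ((k + 1).factorial : ℝ)) •
      T.realOp (σ - s) (lam • R (z s) - z s)) =
      ((t - s) ^ (k + 1) / ((k + 1).factorial : ℝ)) • T.realOp (t - s) (R (z s)) := by
    intro s hs
    rw [uIcc_of_le ht] at hs
    have h1 := T.integral_pow_smul_realOp_gen k (hR.hasGen (z s)) (sub_nonneg.2 hs.2)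
    have h2 := intervalIntegral.integral_comp_sub_right (a := s) (b := t)
      (fun σ => (σ ^ k / (k.factorial : ℝ)) • T.realOp σ (R (z s)) +
        (σ ^ (k + 1) / ((k + 1).factorial : ℝ)) • T.realOp σ (lam • R (z s) - z s)) s
    rw [sub_self, h1] at h2
    exact h2
  simp only [hl] at hsw
  have hck := T.continuous_conv k hz
  have hck' := T.continuous_conv (k + 1) hz
  have hRc : Continuous fun σ => R (T.conv k z σ) := R.continuous.comp hck
  have hRc' : Continuous fun σ => lam • R (T.conv (k + 1) z σ) :=
    (R.continuous.comp hck').const_smul lam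
  have hRs : Continuous fun σ => lam • R (T.conv (k + 1) z σ) - T.conv (k + 1) z σ := hRc'.sub hck'
  rw [intervalIntegral.integral_congr hr, intervalIntegral.integral_add (hint hRc) (hint hRs),
    intervalIntegral.integral_sub (hint hRc') (hint hck'),
    intervalIntegral.integral_smul, ContinuousLinearMap.intervalIntegral_comp_comm R (hint hck),
    ContinuousLinearMap.intervalIntegral_comp_comm R (hint hck')] at hsw
  change _ = T.conv (k + 1) (fun s => R (z s)) t at hsw
  rw [← hR.comm_conv (k + 1) hz] at hsw
  rw [hR, map_sub, map_sub, map_smul, ← sub_eq_zero]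
  rw [← sub_eq_zero] at hsw
  rw [← hsw]
  abel

end Resolvent

end C0Semigroup

/-! ### Confluent Hermite interpolation and partial fractions over a commutative ring. -/

section Hermite

open Polynomial

variable {K ι : Type*} [CommRing K]

/-- The additive group spanned by the products of the `e l` over the multisets of size
`M.card + i` that arise from `M` by raising multiplicities. -/
def multisetSpan (e : ι → K) (M : Multiset ι) (i : ℕ) : AddSubgroup K :=
  AddSubgroup.closure
    {q | ∃ M' : Multiset ι, M ≤ M' ∧ (∀ l ∈ M', l ∈ M) ∧ M'.card = M.card + i ∧ q = (M'.map e).prod}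

theorem mul_pow_mem_multisetSpan {e : ι → K} {M : Multiset ι} {i : ℕ} {q : K}
    (hq : q ∈ multisetSpan e M i) (l : ι) (k : ℕ) :
    e l ^ (k + 1) * q ∈ multisetSpan e (l ::ₘ M) (k + i) := by
  induction hq using AddSubgroup.closure_induction with
  | mem q hq =>
    obtain ⟨M', h1, h2, h3, rfl⟩ := hq
    refine AddSubgroup.subset_closure ⟨Multiset.replicate (k + 1) l + M', ?_, ?_, ?_, ?_⟩
    · rw [Multiset.replicate_succ, Multiset.cons_add]
      exact (Multiset.cons_le_cons_iff l).2 (h1.trans (Multiset.le_add_left _ _))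
    · intro x hx
      rcases Multiset.mem_add.1 hx with hx | hx
      · simp [Multiset.eq_of_mem_replicate hx]
      · exact Multiset.mem_cons_of_mem (h2 x hx)
    · simp only [Multiset.card_add, Multiset.card_replicate, Multiset.card_cons, h3]
      omega
    · simp [pow_succ', mul_assoc]
  | zero => simp
  | add x y _ _ hx hy => rw [mul_add]; exact AddSubgroup.add_mem _ hx hy
  | neg x _ hx => rw [mul_neg]; exact AddSubgroup.neg_mem _ hx

/-- The reciprocal of `∏ (X + d l)` as a power series, with its coefficients. -/
theorem exists_reciprocal_series (d e : ι → K) (M : Multiset ι) (h : ∀ l ∈ M, e l * d l = 1) :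
    ∃ G : PowerSeries K,
      (((M.map fun l => X + C (d l)).prod : K[X]) : PowerSeries K) * G = 1 ∧
      ∀ i, PowerSeries.coeff i G ∈ multisetSpan e M i := by
  induction M using Multiset.induction with
  | empty =>
    refine ⟨1, by simp, fun i => ?_⟩
    rw [PowerSeries.coeff_one]
    split_ifs with hi
    · exact AddSubgroup.subset_closure ⟨0, le_rfl, by simp, by simp [hi], by simp⟩
    · exact AddSubgroup.zero_mem _
  | cons l M ih =>
    obtain ⟨G, hG, hGc⟩ := ih fun l hl => h l (Multiset.mem_cons_of_mem hl)
    have hl := h l (Multiset.mem_cons_self l M)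
    -- The geometric series of $1/(X+d_l)$ with $e_l=d_l^{-1}$.
    let F : PowerSeries K := PowerSeries.mk fun m => (-1) ^ m * e l ^ (m + 1)
    have hF : (PowerSeries.X + PowerSeries.C (d l)) * F = 1 := by
      ext m
      rw [add_mul, map_add, PowerSeries.coeff_C_mul]
      cases m with
      | zero => simpa [F, mul_comm] using hl
      | succ m =>
        rw [PowerSeries.coeff_succ_X_mul]
        simp only [F, PowerSeries.coeff_mk, PowerSeries.coeff_one, Nat.succ_ne_zero, if_false]
        linear_combination (-1) ^ (m + 1) * e l ^ (m + 1) * hl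
    refine ⟨F * G, ?_, fun i => ?_⟩
    · rw [Multiset.map_cons, Multiset.prod_cons, Polynomial.coe_mul, mul_mul_mul_comm, hG, mul_one]
      simpa using hF
    · rw [PowerSeries.coeff_mul]
      refine AddSubgroup.sum_mem _ fun p hp => ?_
      rw [Finset.HasAntidiagonal.mem_antidiagonal] at hp
      have := mul_pow_mem_multisetSpan (hGc p.2) l p.1
      rw [hp] at this
      simp only [F, PowerSeries.coeff_mk, mul_assoc]
      rcases neg_one_pow_eq_or K p.1 with h | h <;> rw [h]
      · simpa using this
      · simpa using this

variable [Fintype ι] [DecidableEq ι]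

/-- The multiset in which every `l ≠ j` occurs `S l` times. -/
def otherIndices (S : ι → ℕ) (j : ι) : Multiset ι :=
  ∑ l ∈ Finset.univ.erase j, Multiset.replicate (S l) l

theorem count_otherIndices (S : ι → ℕ) {j l : ι} (h : l ≠ j) : (otherIndices S j).count l = S l := by
  rw [otherIndices, Multiset.count_sum']
  simp [Multiset.count_replicate, h]

theorem notMem_otherIndices (S : ι → ℕ) (j : ι) : j ∉ otherIndices S j := by
  rw [otherIndices, Multiset.mem_sum]
  rintro ⟨l, hl, h⟩
  exact Finset.ne_of_mem_erase hl (Multiset.eq_of_mem_replicate h).symm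

theorem card_otherIndices (S : ι → ℕ) (j : ι) : (otherIndices S j).card + S j = ∑ l, S l := by
  rw [otherIndices, Multiset.card_sum, ← Finset.sum_erase_add _ _ (Finset.mem_univ j)]
  simp

theorem prod_otherIndices {A : Type*} [CommMonoid A] (S : ι → ℕ) (j : ι) (g : ι → A) :
    ((otherIndices S j).map g).prod = ∏ l ∈ Finset.univ.erase j, g l ^ S l := by
  rw [otherIndices, ← Multiset.coe_mapAddMonoidHom, map_sum, Multiset.prod_sum]
  simp

theorem coeff_taylor_of_natDegree_le {p : K[X]} {N : ℕ} (h : p.natDegree ≤ N) (r : K) :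
    (taylor r p).coeff N = p.coeff N := by
  rw [taylor_coeff]
  have h0 : (hasseDeriv N p).natDegree ≤ 0 :=
    (natDegree_hasseDeriv_le p N).trans (by omega)
  rw [eq_C_of_natDegree_le_zero h0, eval_C, hasseDeriv_coeff]
  simp

/-- A confluent Hermite basis: the polynomials `H (j, k)` of degree less than `∑ S` that interpolate
the `k`-th Taylor coefficient at `b j`. -/
theorem exists_hermite_basis (b : ι → K) (e : ι → ι → K) (he : ∀ j l, l ≠ j → e j l * (b j - b l) = 1)
    (S : ι → ℕ) {n : ℕ} (hn : ∑ l, S l = n) :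
    ∃ (H : (Σ j, Fin (S j)) → K[X]) (c : (Σ j, Fin (S j)) → K),
      (∀ p, c p ∈ multisetSpan (e p.1) (otherIndices S p.1) (S p.1 - 1 - p.2)) ∧
      (∀ p, (H p).coeff (n - 1) = c p) ∧
      (∀ p, (H p).degree < n) ∧
      (∀ i < n, X ^ i = ∑ p, C ((i.choose p.2 : K) * b p.1 ^ (i - p.2)) * H p) ∧
      (0 < n → (∀ j, 0 < S j) → 1 = ∑ p : (Σ j, Fin (S j)),
        C (c p) * ((∏ l ∈ Finset.univ.erase p.1, (X - C (b l)) ^ S l) *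
          (X - C (b p.1)) ^ (S p.1 - 1 - p.2))) := by
  choose G hG hGc using fun j => exists_reciprocal_series (fun l => b j - b l) (e j)
    (otherIndices S j) fun l hl => he j l fun h => notMem_otherIndices S j (h ▸ hl)
  let P : ι → K[X] := fun j => ((otherIndices S j).map fun l => X + C (b j - b l)).prod
  let Q : ι → K[X] := fun j => ∏ l ∈ Finset.univ.erase j, (X - C (b l)) ^ S l
  have hT : ∀ (r : K) (p : K[X]), taylorAlgHom r p = taylor r p := fun _ _ => rfl
  have hPQ : ∀ j, taylor (-b j) (P j) = Q j := fun j => by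
    simp only [P, Q]
    rw [prod_otherIndices, ← hT, map_prod]
    refine Finset.prod_congr rfl fun l _ => ?_
    rw [map_pow, hT, map_add, taylor_X, taylor_C]
    congr 1
    simp only [C_neg, C_sub]
    ring
  -- In the coordinate centred at $b_j$, $Q_j$ becomes $P_j$ and $G_j=P_j^{-1}$. The truncation is
  -- chosen so that $P_jW\equiv X^k$ modulo $X^{S_j}$; translating back and multiplying by $Q_j$
  -- gives the basis element.
  let W : (Σ j, Fin (S j)) → K[X] := fun p => PowerSeries.trunc (S p.1 - p.2) (G p.1) * X ^ (p.2 : ℕ)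
  have hWc : ∀ p m, (W p).coeff m = if (p.2 : ℕ) ≤ m ∧ m < S p.1 then
      PowerSeries.coeff (m - p.2) (G p.1) else 0 := fun p m => by
    have := p.2.2
    simp only [W, coeff_mul_X_pow', PowerSeries.coeff_trunc]
    split_ifs <;> first | rfl | omega
  have hWd : ∀ p, (W p).natDegree ≤ S p.1 - 1 := fun p => by
    refine natDegree_le_iff_coeff_eq_zero.2 fun m hm => ?_
    rw [hWc, if_neg (by omega)]
  let H : (Σ j, Fin (S j)) → K[X] := fun p => Q p.1 * taylor (-b p.1) (W p)
  have hQm : ∀ j, (Q j).Monic := fun j =>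
    monic_prod_of_monic _ _ fun l _ => (monic_X_sub_C _).pow _
  have hQd : ∀ j, (Q j).natDegree ≤ n - S j := fun j => by
    refine (natDegree_prod_le _ _).trans ?_
    have h1 := card_otherIndices S j
    rw [otherIndices, Multiset.card_sum] at h1
    simp only [Multiset.card_replicate] at h1
    refine (Finset.sum_le_sum fun l _ => natDegree_pow_le_of_le (S l) (natDegree_X_sub_C_le _)).trans ?_
    simp only [mul_one]
    omega
  have hSn : ∀ j, S j ≤ n := fun j => hn ▸ Finset.single_le_sum (fun _ _ => Nat.zero_le _)
    (Finset.mem_univ j)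
  have hHd : ∀ p, (H p).natDegree ≤ n - 1 := fun p => by
    refine natDegree_mul_le.trans ?_
    rw [natDegree_taylor]
    have := hQd p.1
    have := hWd p
    have := hSn p.1
    have := p.2.2
    omega
  have hHd' : ∀ p, (H p).degree < n := fun p => by
    have := hSn p.1
    have := p.2.2
    refine (degree_le_of_natDegree_le (hHd p)).trans_lt ?_
    exact_mod_cast (by omega : n - 1 < n)
  have hQcoeff : ∀ j, (Q j).coeff (n - S j) = 1 := fun j => by
    nontriviality K
    have : (Q j).natDegree = n - S j := by
      simp only [Q]
      rw [natDegree_prod_of_monic _ _ fun l _ => (monic_X_sub_C _).pow _]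
      have h1 := card_otherIndices S j
      rw [otherIndices, Multiset.card_sum] at h1
      simp only [Multiset.card_replicate] at h1
      simp only [(monic_X_sub_C _).natDegree_pow, natDegree_X_sub_C, mul_one]
      omega
    rw [← this]
    exact hQm j
  -- $Q_j$ is monic of degree $n-S_j$ and translation preserves the coefficient of degree $S_j-1$,
  -- so only that coefficient of $W$ enters.
  have hHc : ∀ p, (H p).coeff (n - 1) = PowerSeries.coeff (S p.1 - 1 - p.2) (G p.1) := fun p => by
    have h1 := hSn p.1
    have h2 := p.2.2
    have h3 : n - 1 = (n - S p.1) + (S p.1 - 1) := by omega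
    rw [h3, coeff_mul_add_eq_of_natDegree_le (hQd _) (by rw [natDegree_taylor]; exact hWd p),
      hQcoeff, one_mul, coeff_taylor_of_natDegree_le (hWd p), hWc, if_pos (by omega)]
  have hX : ∀ i < n, X ^ i = ∑ p, C ((i.choose p.2 : K) * b p.1 ^ (i - p.2)) * H p := by
    intro i hi
    nontriviality K
    -- The powers of the $X-b_j$ are pairwise coprime because the differences are units, so
    -- divisibility is checked at one node at a time. There only the block of that node matters, and
    -- the coefficients of $(X+b_j)^i$ are exactly the matrix entries.
    have hdvd : (∏ j, (X - C (b j)) ^ S j) ∣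
        X ^ i - ∑ p, C ((i.choose p.2 : K) * b p.1 ^ (i - p.2)) * H p := by
      refine Finset.prod_dvd_of_coprime (fun j _ l _ hjl => ?_) fun j _ => ?_
      · refine (isCoprime_X_sub_C_of_isUnit_sub ?_).pow
        exact IsUnit.of_mul_eq_one_right _ (he j l hjl.symm)
      · rw [Fintype.sum_sigma, ← Finset.add_sum_erase _ _ (Finset.mem_univ j), ← sub_sub]
        refine dvd_sub ?_ (Finset.dvd_sum fun l hl => Finset.dvd_sum fun k _ => ?_)
        · have hloc : (X : K[X]) ^ S j ∣ (X + C (b j)) ^ i -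
              ∑ k : Fin (S j), C ((i.choose k : K) * b j ^ (i - k)) * (P j * W ⟨j, k⟩) := by
            have hPW : ∀ k : Fin (S j), ∀ m < S j,
                (P j * W ⟨j, k⟩).coeff m = if m = k then 1 else 0 := by
              intro k m hm
              have hk := k.2
              have hX : (P j * W ⟨j, k⟩).coeff m = if (k : ℕ) ≤ m then
                  PowerSeries.coeff (m - k) ((P j : PowerSeries K) * G j) else 0 := by
                simp only [W]
                rw [← mul_assoc, coeff_mul_X_pow']
                split_ifs with hkm
                · rw [coeff_mul, PowerSeries.coeff_mul]
                  refine Finset.sum_congr rfl fun q hq => ?_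
                  rw [Finset.HasAntidiagonal.mem_antidiagonal] at hq
                  rw [PowerSeries.coeff_trunc, if_pos (by omega), coeff_coe]
                · rfl
              rw [hX, hG, PowerSeries.coeff_one]
              split_ifs <;> first | rfl | omega
            refine X_pow_dvd_iff.2 fun m hm => ?_
            rw [coeff_sub, coeff_X_add_C_pow, finsetSum_coeff,
              Finset.sum_eq_single (⟨m, hm⟩ : Fin (S j))]
            · rw [coeff_C_mul, hPW _ _ hm]
              simp [mul_comm]
            · intro k _ hk
              rw [coeff_C_mul, hPW _ _ hm, if_neg, mul_zero]
              exact fun h => hk (Fin.ext h.symm)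
            · simp
          have := map_dvd (taylorAlgHom (-b j)) hloc
          simp only [map_pow, map_sub, map_sum, map_mul, map_add] at this
          simp only [hT, taylor_X, taylor_C, hPQ] at this
          simpa [sub_eq_add_neg, H] using this
        · refine Dvd.dvd.mul_left (Dvd.dvd.mul_right ?_ _) _
          exact Finset.dvd_prod_of_mem (fun l => (X - C (b l)) ^ S l)
            (Finset.mem_erase.2 ⟨(Finset.ne_of_mem_erase hl).symm, Finset.mem_univ _⟩)
    have hm : (∏ j, (X - C (b j)) ^ S j).Monic :=
      monic_prod_of_monic _ _ fun l _ => (monic_X_sub_C _).pow _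
    have hdeg : (∏ j, (X - C (b j)) ^ S j).degree = (n : WithBot ℕ) := by
      rw [degree_eq_natDegree hm.ne_zero,
        natDegree_prod_of_monic _ _ fun l _ => (monic_X_sub_C _).pow _]
      simp [(monic_X_sub_C _).natDegree_pow, hn]
    by_contra hne
    refine hm.not_dvd_of_degree_lt (sub_ne_zero.2 hne) ?_ hdvd
    rw [hdeg]
    refine (degree_sub_le _ _).trans_lt (max_lt ?_ ?_)
    · rw [degree_X_pow]
      exact_mod_cast hi
    · refine (degree_sum_le _ _).trans_lt ((Finset.sup_lt_iff (WithBot.bot_lt_coe n)).2 fun p _ => ?_)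
      rw [← smul_eq_C_mul]
      exact (degree_smul_le _ _).trans_lt (hHd' p)
  refine ⟨H, fun p => PowerSeries.coeff (S p.1 - 1 - p.2) (G p.1), fun p => hGc _ _, hHc, hHd', hX, ?_⟩
  intro h0 hS
  -- The partial fraction identity is the case $i=0$ of interpolation: $\binom0k$ keeps only the
  -- elements with $k=0$, whose factor $W$ is the truncation of $G_j$ summed in reverse order.
  rw [← pow_zero X, hX 0 h0, Fintype.sum_sigma, Fintype.sum_sigma]
  refine Finset.sum_congr rfl fun j _ => ?_
  have hW0 : W ⟨j, ⟨0, hS j⟩⟩ = ∑ k : Fin (S j),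
      C (PowerSeries.coeff (S j - 1 - k) (G j)) * X ^ (S j - 1 - k) := by
    rw [Fin.sum_univ_eq_sum_range (fun k => C (PowerSeries.coeff (S j - 1 - k) (G j)) *
      (X : K[X]) ^ (S j - 1 - k)), Finset.sum_range_reflect (fun k =>
      C (PowerSeries.coeff k (G j)) * (X : K[X]) ^ k)]
    ext m
    rw [hWc, finsetSum_coeff]
    simp only [coeff_C_mul_X_pow, Finset.sum_ite_eq, Finset.mem_range]
    simp
  rw [Finset.sum_eq_single (⟨0, hS j⟩ : Fin (S j))]
  · simp only [Nat.choose_self, Nat.cast_one, Nat.sub_zero, pow_zero, mul_one, map_one, one_mul, H,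
      hW0]
    rw [← hT, map_sum, Finset.mul_sum]
    refine Finset.sum_congr rfl fun k _ => ?_
    rw [map_mul, map_pow, hT, hT, taylor_C, taylor_X, C_neg, ← sub_eq_add_neg]
    ring
  · intro k _ hk
    rw [Nat.choose_eq_zero_of_lt (Nat.pos_of_ne_zero fun h => hk (Fin.ext h))]
    simp
  · simp

end Hermite

-- Localization of a module at the scalars acting injectively.

universe u

/-- A module embeds into its localization at the scalars that act injectively. -/
theorem exists_injective_localizedModule (A V : Type u) [CommRing A] [AddCommGroup V] [Module A V] :
    ∃ (K : Type u) (_ : CommRing K) (Y : Type u) (_ : AddCommGroup Y) (_ : Module K Y)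
      (ι : V →+ Y) (φ : A →+* K), Function.Injective ι ∧ (∀ (a : A) v, ι (a • v) = φ a • ι v) ∧
      ∀ a : A, Function.Injective (fun v : V => a • v) → IsUnit (φ a) := by
  let M : Submonoid A :=
    { carrier := {a | Function.Injective fun v : V => a • v}
      one_mem' := fun v w h => by simpa using h
      mul_mem' := fun {a b} ha hb v w h => hb (ha (by simpa only [mul_smul] using h)) }
  refine ⟨Localization M, inferInstance, LocalizedModule M V, inferInstance,
    inferInstance, (LocalizedModule.mkLinearMap M V).toAddMonoidHom, algebraMap _ _, ?_, ?_, ?_⟩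
  · refine (injective_iff_map_eq_zero _).2 fun v hv => ?_
    -- The kernel consists of the elements killed by an inverted scalar, and these scalars act
    -- injectively.
    obtain ⟨a, ha⟩ := (IsLocalizedModule.eq_zero_iff M (LocalizedModule.mkLinearMap M V)).1 hv
    exact a.2 (ha.trans (smul_zero _).symm)
  · intro a v
    rw [algebraMap_smul]
    exact (LocalizedModule.mkLinearMap M V).map_smul a v
  · intro a ha
    exact IsLocalization.map_units (Localization M) (⟨a, ha⟩ : M)

/-- A vector space embeds into a module over a commutative ring to which the algebra `A` generated
by given commuting operators maps, in such a way that the injective operators in `A` become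
invertible. -/
theorem exists_injective_localization {V : Type u} [AddCommGroup V] [Module ℝ V]
    (s : Set (Module.End ℝ V)) (hs : ∀ F ∈ s, ∀ G ∈ s, F * G = G * F) :
    ∃ (A : Type u) (_ : CommRing A) (ψ : A →+* Module.End ℝ V) (K : Type u) (_ : CommRing K)
      (Y : Type u) (_ : AddCommGroup Y) (_ : Module K Y) (ι : V →+ Y) (φ : A →+* K),
      (∀ F ∈ s, ∃ a, ψ a = F) ∧ (∀ c : ℝ, ∃ a, ∀ v, ψ a v = c • v) ∧ Function.Injective ι ∧
      (∀ a v, ι (ψ a v) = φ a • ι v) ∧ ∀ a, Function.Injective (ψ a) → IsUnit (φ a) := by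
  have := Algebra.isMulCommutative_adjoin ℝ hs
  let _ : CommRing (Algebra.adjoin ℝ s) :=
    { (inferInstance : Ring (Algebra.adjoin ℝ s)) with mul_comm := mul_comm' }
  let ψ : Algebra.adjoin ℝ s →+* Module.End ℝ V := (Algebra.adjoin ℝ s).val.toRingHom
  let _ : Module (Algebra.adjoin ℝ s) V := Module.compHom V ψ
  obtain ⟨K, hK, Y, hY, hM, ι, φ, h1, h2, h3⟩ :=
    exists_injective_localizedModule (Algebra.adjoin ℝ s) V
  exact ⟨Algebra.adjoin ℝ s, inferInstance, ψ, K, hK, Y, hY, hM, ι, φ,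
    fun F hF => ⟨⟨F, Algebra.subset_adjoin hF⟩, rfl⟩,
    fun c => ⟨algebraMap ℝ (Algebra.adjoin ℝ s) c, fun v => rfl⟩, h1, h2, h3⟩

/-! ### The primitive operator on continuous functions. -/

section FunctionSpace

variable {X : Type*} [NormedAddCommGroup X] {τ : ℝ}

theorem continuous_extend (hτ : 0 ≤ τ) (g : C(Icc 0 τ, X)) : Continuous (IccExtend hτ g) :=
  g.continuous.Icc_extend'

variable [NormedSpace ℝ X]

/-- The primitive that vanishes at `0` of a continuous function on `[0, τ]`. -/
noncomputable def primitiveOp (X : Type*) [NormedAddCommGroup X] [NormedSpace ℝ X] (hτ : 0 ≤ τ) :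
    Module.End ℝ C(Icc 0 τ, X) where
  toFun g := ⟨fun t => ∫ s in (0 : ℝ)..t, IccExtend hτ g s,
    (intervalIntegral.continuous_primitive
      (fun a b => (continuous_extend hτ g).intervalIntegrable a b) 0).comp
      continuous_subtype_val⟩
  map_add' g h := by
    ext t
    exact intervalIntegral.integral_add
      ((continuous_extend hτ g).intervalIntegrable _ _)
      ((continuous_extend hτ h).intervalIntegrable _ _)
  map_smul' c g := by
    ext t
    exact intervalIntegral.integral_smul c _

theorem primitiveOp_apply (hτ : 0 ≤ τ) (g : C(Icc 0 τ, X)) (t : Icc 0 τ) :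
    primitiveOp X hτ g t = ∫ s in (0 : ℝ)..t, IccExtend hτ g s := rfl

theorem hasDerivWithinAt_primitiveOp [CompleteSpace X] (hτ : 0 ≤ τ) (g : C(Icc 0 τ, X))
    (t : Icc 0 τ) : HasDerivWithinAt (IccExtend hτ (primitiveOp X hτ g)) (g t) (Icc 0 τ) t := by
  have h := ((continuous_extend hτ g).integral_hasStrictDerivAt 0 t).hasDerivAt.hasDerivWithinAt
    (s := Icc 0 τ)
  rw [IccExtend_val] at h
  refine h.congr_of_mem (fun s hs => ?_) t.2
  rw [IccExtend_of_mem hτ _ hs, primitiveOp_apply]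

theorem primitiveOp_injective [CompleteSpace X] (hτ : 0 < τ) :
    Function.Injective (primitiveOp X hτ.le) := by
  refine (injective_iff_map_eq_zero _).2 fun g hg => ?_
  ext t
  have h := hasDerivWithinAt_primitiveOp hτ.le g t
  rw [hg] at h
  exact (uniqueDiffOn_Icc hτ t t.2).eq_deriv _ h
    ((hasDerivWithinAt_const (t : ℝ) (Icc 0 τ) (0 : X)).congr (fun _ _ => rfl) rfl)

/-- A function with a continuous derivative is its value at `0` plus the primitive of it. -/
theorem eq_const_add_primitiveOp [CompleteSpace X] (hτ : 0 ≤ τ) (g g' : C(Icc 0 τ, X))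
    (h : ∀ t : Icc 0 τ, HasDerivWithinAt (IccExtend hτ g) (g' t) (Icc 0 τ) t) :
    g = ContinuousMap.const _ (g ⟨0, left_mem_Icc.2 hτ⟩) + primitiveOp X hτ g' := by
  ext t
  have := intervalIntegral.integral_eq_sub_of_hasDeriv_right (a := 0) (b := t)
    (f := IccExtend hτ g) (f' := IccExtend hτ g') (continuous_extend hτ g).continuousOn
    (fun s hs => by
      rw [min_eq_left t.2.1, max_eq_right t.2.1] at hs
      have hs' : s ∈ Icc 0 τ := ⟨hs.1.le, hs.2.le.trans t.2.2⟩
      rw [IccExtend_of_mem hτ _ hs']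
      refine (h ⟨s, hs'⟩).mono_of_mem_nhdsWithin ?_
      exact mem_nhdsWithin_of_mem_nhds (Icc_mem_nhds hs.1 (hs.2.trans_le t.2.2)))
    ((continuous_extend hτ g').intervalIntegrable _ _)
  rw [ContinuousMap.add_apply, primitiveOp_apply, this, IccExtend_val,
    IccExtend_of_mem hτ _ (left_mem_Icc.2 hτ), ContinuousMap.const_apply]
  abel

theorem primitiveOp_comm [CompleteSpace X] (hτ : 0 ≤ τ) (R : X →L[ℝ] X) (g : C(Icc 0 τ, X)) :
    R.compLeftContinuous ℝ (Icc 0 τ) (primitiveOp X hτ g) =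
      primitiveOp X hτ (R.compLeftContinuous ℝ (Icc 0 τ) g) := by
  ext t
  change R (primitiveOp X hτ g t) = _
  rw [primitiveOp_apply, primitiveOp_apply, ← ContinuousLinearMap.intervalIntegral_comp_comm R
    ((continuous_extend hτ g).intervalIntegrable _ _)]
  rfl

end FunctionSpace

/-! ### The symbol calculus. -/

section Symbols

variable {𝕜 : Type*} {X : Type u} [RCLike 𝕜] [NormedAddCommGroup X] [NormedSpace 𝕜 X]
  [NormedSpace ℝ X] [IsScalarTower ℝ 𝕜 X] [CompleteSpace X]

/-- An extension `Y` of `C([0, τ]; X)` on which a commutative ring `K` acts in such a way that the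
generators are elements `b j`, the operator `d/dt` with zero initial value is an element `x`, and
the elements `b j - b l` and `x - b j` are invertible. -/
structure SymbolCalculus {r : ℕ} (T : Fin r → C0Semigroup 𝕜 X) {τ : ℝ} (hτ : 0 < τ)
    (K Y : Type*) [CommRing K] [AddCommGroup Y] [Module K Y] where
  /-- the embedding -/
  ι : C(Icc 0 τ, X) →+ Y
  /-- the symbols of the generators -/
  b : Fin r → K
  /-- the symbol of `d/dt` -/
  x : K
  injective : Function.Injective ι
  gen_iff : ∀ j g h, ι h = b j • ι g ↔ ∀ t, (T j).HasGen (g t) (h t)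
  primitive_iff : ∀ g h, ι h = x • ι g ↔ primitiveOp X hτ.le h = g
  isUnit_sub : ∀ j l, l ≠ j → IsUnit (b j - b l)
  isUnit_x_sub : ∀ j, IsUnit (x - b j)

/-- With $b_j=\lambda-P_j^{-1}$ and $x=J^{-1}$ one has $b_j-b_l=P_j^{-1}P_l^{-1}(P_j-P_l)$ and
$x-b_j=J^{-1}P_j^{-1}\bigl(P_j-J(\lambda P_j-1)\bigr)$. It remains to see that the last factors are
injective operators. -/
theorem exists_symbolCalculus {r : ℕ} (T : Fin r → C0Semigroup 𝕜 X)
    (hcomm : ∀ j k s t, ((T j).op s).comp ((T k).op t) = ((T k).op t).comp ((T j).op s))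
    (hinj : ∀ j k, j ≠ k → ∀ u v, (T j).HasGen u v → (T k).HasGen u v → u = 0)
    {τ : ℝ} (hτ : 0 < τ) :
    ∃ (K : Type u) (_ : CommRing K) (Y : Type u) (_ : AddCommGroup Y) (_ : Module K Y),
      Nonempty (SymbolCalculus T hτ K Y) := by
  obtain ⟨lam, hlam⟩ := (eventually_all.2 fun j => (T j).eventually_exists_isResolvent).exists
  choose R hR using hlam
  set J := primitiveOp X hτ.le with hJ
  let P : Fin r → Module.End ℝ C(Icc 0 τ, X) := fun j => (R j).compLeftContinuous ℝ (Icc 0 τ)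
  have hP : ∀ j g t, P j g t = R j (g t) := fun _ _ _ => rfl
  have hPJ : ∀ j g, P j (J g) = J (P j g) := fun j g => primitiveOp_comm hτ.le (R j) g
  have hPP : ∀ j l, P j * P l = P l * P j := fun j l => by
    ext g t
    exact (hR j).comm_of_comm (hR l) (hcomm j l) (g t)
  let s : Set (Module.End ℝ C(Icc 0 τ, X)) := insert J (range P)
  have hs : ∀ F ∈ s, ∀ G ∈ s, F * G = G * F := by
    rintro F (rfl | ⟨j, rfl⟩) G (rfl | ⟨l, rfl⟩)
    · rfl
    · exact (LinearMap.ext (hPJ l)).symm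
    · exact LinearMap.ext (hPJ j)
    · exact hPP j l
  obtain ⟨A, _, ψ, K, _, Y, _, _, ι, φ, hψs, hψc, hι, hφ, hunit⟩ :=
    exists_injective_localization s hs
  obtain ⟨J', hJ'⟩ := hψs J (mem_insert _ _)
  choose P' hP' using fun j => hψs (P j) (mem_insert_of_mem _ (mem_range_self j))
  obtain ⟨c, hc⟩ := hψc lam
  have hPinj : ∀ j, Function.Injective (P j) := fun j =>
    (injective_iff_map_eq_zero _).2 fun g hg => by
      ext t
      exact (hR j).injective ((DFunLike.congr_fun hg t).trans (map_zero (R j)).symm)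
  have hJinj : Function.Injective J := primitiveOp_injective hτ
  obtain ⟨uJ, huJ⟩ := hunit J' (by rw [hJ']; exact hJinj)
  choose uP huP using fun j => hunit (P' j) (by rw [hP' j]; exact hPinj j)
  refine ⟨K, inferInstance, Y, inferInstance, inferInstance, ⟨ι, fun j => φ c - ↑(uP j)⁻¹, ↑uJ⁻¹,
    hι, fun j g h => ?_, fun g h => ?_, fun j l hjl => ?_, fun j => ?_⟩⟩
  · have h1 : ι h = (φ c - ↑(uP j)⁻¹) • ι g ↔ φ (P' j) • ι h = φ (P' j * c - 1) • ι g := by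
      have h2 : φ (P' j * c - 1) = (uP j : K) * (φ c - ↑(uP j)⁻¹) := by
        rw [map_sub, map_mul, map_one, mul_sub, Units.mul_inv, huP]
      rw [h2, ← huP, mul_smul]
      exact (smul_left_cancel_iff (uP j)).symm
    rw [h1, ← hφ, ← hφ, hι.eq_iff, map_sub, map_mul, map_one, hP']
    rw [DFunLike.ext_iff]
    refine forall_congr' fun t => ?_
    rw [hR j]
    have h3 : (P j * ψ c - 1) g t = lam • R j (g t) - g t := by
      rw [LinearMap.sub_apply, Module.End.mul_apply, hc, Module.End.one_apply, map_smul]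
      rfl
    rw [h3, hP, map_sub, map_smul, eq_sub_iff_add_eq, ← eq_sub_iff_add_eq', eq_comm]
  · rw [← hJ, ← hι.eq_iff, ← hJ', hφ, ← huJ]
    constructor
    · intro h1
      rw [h1, smul_smul, Units.mul_inv, one_smul]
    · intro h1
      rw [← h1, smul_smul, Units.inv_mul, one_smul]
  · have h1 : Function.Injective (ψ (P' j - P' l)) := by
      rw [map_sub, hP', hP']
      refine (injective_iff_map_eq_zero _).2 fun g hg => ?_
      ext t
      have h2 : R j (g t) = R l (g t) := sub_eq_zero.1 (DFunLike.congr_fun hg t)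
      have h3 := (hR l).hasGen (g t)
      rw [← h2] at h3
      exact (hR j).injective
        ((hinj j l hjl.symm _ _ ((hR j).hasGen (g t)) h3).trans (map_zero (R j)).symm)
    obtain ⟨v, hv⟩ := hunit _ h1
    have h2 : (φ c - ↑(uP j)⁻¹) - (φ c - ↑(uP l)⁻¹) = ↑((uP j)⁻¹ * (uP l)⁻¹ * v : Kˣ) := by
      push_cast
      rw [hv, map_sub, ← huP, ← huP]
      linear_combination (-((uP l)⁻¹ : Kˣ) : K) * (uP j).inv_mul +
        ((uP j)⁻¹ : Kˣ) * (uP l).inv_mul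
    rw [h2]
    exact Units.isUnit _
  · have h1 : Function.Injective (ψ (P' j - J' * (P' j * c - 1))) := by
      refine (injective_iff_map_eq_zero _).2 fun g hg => ?_
      have h2 : P j g = J (lam • P j g - g) := by
        rw [map_sub, map_mul, map_sub, map_mul, map_one, hP', hJ', LinearMap.sub_apply,
          Module.End.mul_apply, LinearMap.sub_apply, Module.End.mul_apply, hc, map_smul,
          Module.End.one_apply, sub_eq_zero] at hg
        exact hg
      have h3 : ∀ t : Icc 0 τ, (T j).HasGen (J g t) (g t) := fun t => by
        rw [hR j, map_sub, map_smul]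
        have h4 : P j g t = J (lam • P j g - g) t := DFunLike.congr_fun h2 t
        rw [map_sub, map_smul, ← hPJ] at h4
        rw [← hP, ← hP, h4]
        change lam • P j (J g) t - (lam • P j (J g) t - J g t) = _
        abel
      refine (map_eq_zero_iff J hJinj).1 ?_
      ext t
      refine (T j).eq_zero_of_hasGen_integral (continuous_extend hτ.le g) (fun t ht => ?_) t.2
      have := h3 ⟨t, ht⟩
      rw [hJ, primitiveOp_apply] at this
      rwa [IccExtend_of_mem hτ.le _ ht]
    obtain ⟨v, hv⟩ := hunit _ h1
    have h2 : (↑uJ⁻¹ : K) - (φ c - ↑(uP j)⁻¹) = ↑(uJ⁻¹ * (uP j)⁻¹ * v : Kˣ) := by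
      push_cast
      rw [hv, map_sub, map_mul, map_sub, map_mul, map_one, ← huP, ← huJ]
      linear_combination (-(uJ⁻¹ : Kˣ) : K) * (uP j).inv_mul +
        (((uP j)⁻¹ : Kˣ) * (uP j * φ c - 1)) * uJ.inv_mul + φ c * (uP j).inv_mul
    rw [h2]
    exact Units.isUnit _

end Symbols

/-! ### Shorter sequences in the range condition. -/

section Ranges

variable {𝕜 X : Type*} [RCLike 𝕜] [NormedAddCommGroup X] [NormedSpace 𝕜 X] {τ : ℝ} {r : ℕ}

theorem InRange.of_append (C : X →ₗ.[𝕜] X) (L L' : List (X →ₗ.[𝕜] X)) {f : ℝ → X}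
    (h : InRange C τ (L ++ L') f) : InRange C τ L f := by
  induction L generalizing f with
  | nil =>
    cases L' with
    | nil => exact h
    | cons D L' => exact h.1
  | cons D L ih =>
    obtain ⟨h0, g, Cg, Dg, h1, h2, h3⟩ := h
    exact ⟨h0, g, Cg, Dg, h1, ih h2, ih h3⟩

/-- The hypothesis concerns length exactly $n-1$; a shorter list is padded with an arbitrary $l\ne
j$. If no such $l$ exists the list is empty and only continuity is claimed. -/
theorem RangesLargeEnough.inRange {n : ℕ} {B : Fin r → X →ₗ.[𝕜] X} {S : Fin r → ℕ}
    {f : ℝ → X} (h : RangesLargeEnough n B S τ f) (hf : ContinuousOn f (Icc 0 τ)) (j : Fin r)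
    (L : List (Fin r)) (hj : j ∉ L) (hL : L.length ≤ n - 1) (hS : ∀ l, l ≠ j → S l ≤ L.count l) :
    InRange (B j) τ (L.map B) f := by
  by_cases hl : ∃ l, l ≠ j
  · obtain ⟨l, hl⟩ := hl
    refine InRange.of_append _ _ ((List.replicate (n - 1 - L.length) l).map B) ?_
    rw [← List.map_append]
    refine h j _ ?_ ?_ fun k hk => (hS k hk).trans ?_
    · rw [List.mem_append, not_or]
      exact ⟨hj, fun h => hl (List.eq_of_mem_replicate h).symm⟩
    · rw [List.length_append, List.length_replicate]
      omega
    · rw [List.count_append]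
      exact Nat.le_add_right _ _
  · push Not at hl
    obtain rfl : L = [] := List.eq_nil_iff_forall_not_mem.2 fun l hlL => hj (hl l ▸ hlL)
    exact hf

end Ranges

/-! ### Mild solutions and convolutions in terms of symbols. -/

namespace SymbolCalculus

variable {𝕜 : Type*} {X : Type u} [RCLike 𝕜] [NormedAddCommGroup X] [NormedSpace 𝕜 X]
  [NormedSpace ℝ X] {r : ℕ} {T : Fin r → C0Semigroup 𝕜 X} {τ : ℝ}
  {hτ : 0 < τ} {K Y : Type*} [CommRing K] [AddCommGroup Y] [Module K Y]
  (Φ : SymbolCalculus T hτ K Y)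

theorem x_smul_primitive (g : C(Icc 0 τ, X)) : Φ.x • Φ.ι (primitiveOp X hτ.le g) = Φ.ι g :=
  ((Φ.primitive_iff _ _).2 rfl).symm

/-- A mild solution of the equation `y = B y` with forcing term `w` in integrated form. -/
theorem x_sub_smul_of_mild {j : Fin r} {y w : C(Icc 0 τ, X)}
    (h : ∀ t, (T j).HasGen (primitiveOp X hτ.le y t) (y t - w t)) :
    (Φ.x - Φ.b j) • Φ.ι y = Φ.x • Φ.ι w := by
  have h1 := (Φ.gen_iff j (primitiveOp X hτ.le y) (y - w)).2 h
  rw [map_sub, ← Φ.x_smul_primitive y] at h1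
  rw [← Φ.x_smul_primitive y, smul_smul, sub_mul, mul_comm (Φ.b j), sub_smul, mul_smul, mul_smul,
    ← h1, ← smul_sub, sub_sub_cancel]

theorem x_sub_smul_of_solution {j : Fin r} {v v' g : C(Icc 0 τ, X)}
    (hv : v = primitiveOp X hτ.le v') (h : ∀ t, (T j).HasGen (v t) (v' t - g t)) :
    (Φ.x - Φ.b j) • Φ.ι v = Φ.ι g := by
  have h1 := (Φ.gen_iff j v (v' - g)).2 h
  have h2 := (Φ.primitive_iff v v').2 hv.symm
  rw [sub_smul, ← h1, ← h2, ← map_sub, sub_sub_cancel]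

variable [IsScalarTower ℝ 𝕜 X] [CompleteSpace X]

/-- The convolution of `t ↦ t ^ k / k! • T(t)` with a function on `[0, τ]`. -/
noncomputable def _root_.C0Semigroup.convC (T : C0Semigroup 𝕜 X) (hτ : 0 ≤ τ) (k : ℕ)
    (z : C(Icc 0 τ, X)) : C(Icc 0 τ, X) :=
  ⟨fun t => T.conv k (IccExtend hτ z) t,
    (T.continuous_conv k (continuous_extend hτ z)).comp continuous_subtype_val⟩

theorem _root_.C0Semigroup.primitiveOp_convC (T : C0Semigroup 𝕜 X) (hτ : 0 ≤ τ) (k : ℕ)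
    (z : C(Icc 0 τ, X)) (t : Icc 0 τ) :
    primitiveOp X hτ (T.convC hτ k z) t = ∫ s in (0 : ℝ)..t, T.conv k (IccExtend hτ z) s := by
  refine intervalIntegral.integral_congr fun s hs => ?_
  rw [uIcc_of_le t.2.1] at hs
  exact IccExtend_of_mem hτ _ ⟨hs.1, hs.2.trans t.2.2⟩

/-- Convolution with the $k$-th kernel is division by $(x-b_j)^{k+1}$; each factor $x-b_j$ lowers
$k$ by one. -/
theorem x_sub_pow_smul_convC (j : Fin r) (k : ℕ) (z : C(Icc 0 τ, X)) :
    (Φ.x - Φ.b j) ^ (k + 1) • Φ.ι ((T j).convC hτ.le k z) = Φ.ι z := by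
  induction k with
  | zero =>
    rw [zero_add, pow_one, ← Φ.x_smul_primitive z]
    refine Φ.x_sub_smul_of_mild fun t => ?_
    rw [(T j).primitiveOp_convC]
    exact (T j).hasGen_integral_conv_zero (continuous_extend hτ.le z) t.2.1
  | succ k ih =>
    rw [pow_succ, mul_smul, ← ih, ← Φ.x_smul_primitive ((T j).convC hτ.le k z)]
    congr 1
    refine Φ.x_sub_smul_of_mild fun t => ?_
    rw [(T j).primitiveOp_convC, (T j).primitiveOp_convC]
    exact (T j).hasGen_integral_conv_succ k (continuous_extend hτ.le z) t.2.1

/-- The inhomogeneous problem with zero initial value and continuously differentiable right-hand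
side has a classical solution. -/
theorem exists_solution (Φ : SymbolCalculus T hτ K Y) (j : Fin r) (g g' : C(Icc 0 τ, X)) (g₀ : X)
    (hg : g = ContinuousMap.const _ g₀ + primitiveOp X hτ.le g') :
    ∃ v : C(Icc 0 τ, X), ∀ t, (T j).HasGen (primitiveOp X hτ.le v t) (v t - g t) := by
  let o : C(Icc 0 τ, X) := ⟨fun t => (T j).realOp t g₀,
    (T j).continuous_realOp continuous_subtype_val continuous_const⟩
  have ho : (Φ.x - Φ.b j) • Φ.ι o = Φ.x • Φ.ι (ContinuousMap.const _ g₀) := by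
    refine Φ.x_sub_smul_of_mild fun t => ?_
    have : primitiveOp X hτ.le o t = ∫ s in (0 : ℝ)..t, (T j).realOp s g₀ := by
      refine intervalIntegral.integral_congr fun s hs => ?_
      rw [uIcc_of_le t.2.1] at hs
      exact IccExtend_of_mem hτ.le o ⟨hs.1, hs.2.trans t.2.2⟩
    rw [this]
    exact (T j).hasGen_integral t.2.1 g₀
  have h0 (z : C(Icc 0 τ, X)) : (Φ.x - Φ.b j) • Φ.ι ((T j).convC hτ.le 0 z) = Φ.ι z := by
    simpa using Φ.x_sub_pow_smul_convC j 0 z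
  -- This is the derivative of the convolution of $T_j$ with $g$; `hy` says so in symbols, by
  -- cancelling the unit $x-b_j$.
  let y := o + (T j).convC hτ.le 0 g'
  have hy : Φ.ι y = Φ.x • Φ.ι ((T j).convC hτ.le 0 g) := by
    rw [← (Φ.isUnit_x_sub j).smul_left_cancel, smul_comm, h0, map_add, smul_add, ho, h0, hg,
      map_add, smul_add, Φ.x_smul_primitive]
  refine ⟨y, (Φ.gen_iff j _ (y - g)).1 ?_⟩
  rw [(Φ.primitive_iff _ _).1 hy, map_sub, hy, ← h0 g, sub_smul, sub_sub_cancel]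

end SymbolCalculus

/-! ### Successive division by differences of symbols. -/

namespace SymbolCalculus

variable {𝕜 : Type*} {X : Type u} [RCLike 𝕜] [NormedAddCommGroup X] [NormedSpace 𝕜 X]
  [NormedSpace ℝ X] [IsScalarTower ℝ 𝕜 X] {r : ℕ} {T : Fin r → C0Semigroup 𝕜 X} {τ : ℝ}
  {hτ : 0 < τ} {K Y : Type*} [CommRing K] [AddCommGroup Y] [Module K Y]
  (Φ : SymbolCalculus T hτ K Y)

/-- A function that can be divided successively lies in the range of the corresponding quotients of
symbols. -/
theorem mem_range_of_inRange {e : Fin r → Fin r → K}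
    (he : ∀ j l, l ≠ j → e j l * (Φ.b j - Φ.b l) = 1) (j : Fin r) (L : List (Fin r)) (hj : j ∉ L)
    {f : ℝ → X} (hf : InRange (T j).generator τ (L.map fun l => (T l).generator) f)
    (F : C(Icc 0 τ, X)) (hF : ∀ t, F t = f t) {a : ℕ} (ha : a ≤ L.length) :
    (Φ.b j ^ a * (L.map (e j)).prod) • Φ.ι F ∈ Φ.ι.range := by
  induction L generalizing f F a with
  | nil =>
    obtain rfl : a = 0 := by simpa using ha
    exact ⟨F, by simp⟩
  | cons l L ih =>
    obtain ⟨hjl, hjL⟩ := List.ne_and_not_mem_of_not_mem_cons hj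
    obtain ⟨-, h, Ch, Dh, hgr, h1, h2⟩ := hf
    have hc : ∀ (L : List (X →ₗ.[𝕜] X)) (g : ℝ → X), InRange (T j).generator τ L g →
        ContinuousOn g (Icc 0 τ) := by
      rintro (_ | ⟨D, L⟩) g hg
      exacts [hg, hg.1]
    let H : C(Icc 0 τ, X) := ⟨_, (hc _ _ h1).domRestrict⟩
    let CH : C(Icc 0 τ, X) := ⟨_, (hc _ _ h2).domRestrict⟩
    have hCH : Φ.ι CH = Φ.b j • Φ.ι H := (Φ.gen_iff _ _ _).2 fun t =>
      ((T j).mem_graph_generator _ _).1 (hgr t t.2).1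
    have hDH : Φ.ι (CH - F) = Φ.b l • Φ.ι H := (Φ.gen_iff _ _ _).2 fun t => by
      have h3 := hgr t t.2
      have h4 : (CH - F) t = Dh t := by
        rw [ContinuousMap.sub_apply, hF, ← h3.2.2]
        exact sub_sub_cancel _ _
      rw [h4]
      exact ((T l).mem_graph_generator _ _).1 h3.2.1
    have hFH : Φ.ι H = e j l • Φ.ι F := by
      have h3 : Φ.ι F = (Φ.b j - Φ.b l) • Φ.ι H := by
        rw [sub_smul, ← hCH, ← hDH, map_sub, sub_sub_cancel]
      rw [h3, smul_smul, he j l hjl.symm, one_smul]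
    rw [List.map_cons, List.prod_cons]
    -- Each division leaves a choice between $h$ and $B_jh$ for the next one; choosing $B_jh$
    -- absorbs one factor $b_j$, which is why at most as many factors as divisions are allowed.
    cases a with
    | zero =>
      have := ih hjL h1 H (fun _ => rfl) (Nat.zero_le _)
      rwa [hFH, smul_smul, mul_assoc, mul_comm _ (e j l)] at this
    | succ a =>
      have := ih hjL h2 CH (fun _ => rfl) (Nat.succ_le_succ_iff.1 ha)
      rw [hCH, hFH, smul_smul, smul_smul] at this
      convert this using 2
      ring

/-- A generator of the span is a product of $n-S_j+m$ inverses, which is at most $n-1$ divisions by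
`hm` and leaves room for $b_j^a$ by `ha`. -/
theorem mem_range_of_mem_multisetSpan {e : Fin r → Fin r → K}
    (he : ∀ j l, l ≠ j → e j l * (Φ.b j - Φ.b l) = 1) {n : ℕ} {S : Fin r → ℕ} (hn : ∑ l, S l = n)
    {f : ℝ → X} (hR : RangesLargeEnough n (fun l => (T l).generator) S τ f)
    (hf : ContinuousOn f (Icc 0 τ)) (F : C(Icc 0 τ, X)) (hF : ∀ t, F t = f t) {j : Fin r}
    {m a : ℕ} (hm : m + 1 ≤ S j) (ha : a + S j ≤ n + m) {c : K}
    (hc : c ∈ multisetSpan (e j) (otherIndices S j) m) :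
    (Φ.b j ^ a * c) • Φ.ι F ∈ Φ.ι.range := by
  induction hc using AddSubgroup.closure_induction with
  | mem c hc =>
    obtain ⟨M, h1, h2, h3, rfl⟩ := hc
    have hcard := card_otherIndices S j
    have hj : j ∉ M.toList := fun h => notMem_otherIndices S j (h2 j (Multiset.mem_toList.1 h))
    have hlen : M.toList.length = M.card := Multiset.length_toList M
    have h4 := hR.inRange hf j M.toList hj (by omega) fun l hl => by
      rw [← Multiset.coe_count, Multiset.coe_toList, ← count_otherIndices S hl]
      exact Multiset.count_le_of_le l h1
    have h5 := Φ.mem_range_of_inRange he j M.toList hj h4 F hF (a := a) (by omega)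
    rwa [← Multiset.prod_map_toList]
  | zero => simp
  | add c d _ _ h1 h2 =>
    rw [mul_add, add_smul]
    exact AddSubgroup.add_mem _ h1 h2
  | neg c _ h =>
    rw [mul_neg, neg_smul]
    exact AddSubgroup.neg_mem _ h

end SymbolCalculus

/-! ### Graphs of powers, of the operator matrix and of its inverse. -/

section OperatorMatrix

variable {𝕜 X : Type*} [RCLike 𝕜] [NormedAddCommGroup X] [NormedSpace 𝕜 X]

theorem mem_graph_partialComp {C B : X →ₗ.[𝕜] X} {u v : X} :
    (u, v) ∈ (partialComp C B).graph ↔ ∃ w, (u, w) ∈ B.graph ∧ (w, v) ∈ C.graph := by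
  constructor
  · intro h
    obtain ⟨a, rfl, rfl⟩ := LinearPMap.mem_graph_iff _ |>.1 h
    obtain ⟨d, hd, hda⟩ := a.2
    have hda' : (d : X) = a := hda
    have hd' : d = ⟨a, hda' ▸ d.2⟩ := Subtype.ext hda'
    rw [hd'] at hd
    exact ⟨B ⟨a, hda' ▸ d.2⟩, LinearPMap.mem_graph B ⟨a, hda' ▸ d.2⟩,
      LinearPMap.mem_graph_iff _ |>.2 ⟨⟨_, hd⟩, rfl, rfl⟩⟩
  · rintro ⟨w, h1, h2⟩
    obtain ⟨d, rfl, rfl⟩ := LinearPMap.mem_graph_iff _ |>.1 h1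
    obtain ⟨c, hc, rfl⟩ := LinearPMap.mem_graph_iff _ |>.1 h2
    refine LinearPMap.mem_graph_iff _ |>.2 ⟨⟨d, d, ?_, rfl⟩, rfl, ?_⟩
    · change B d ∈ C.domain
      have hc' : (c : X) = B d := hc
      rw [← hc']
      exact c.2
    · exact congrArg C (Subtype.ext hc.symm)

theorem mem_graph_partialPow_zero {B : X →ₗ.[𝕜] X} {u v : X} :
    (u, v) ∈ (partialPow B 0).graph ↔ u = v := by
  rw [LinearPMap.mem_graph_iff]
  constructor
  · rintro ⟨a, rfl, h⟩
    exact h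
  · rintro rfl
    exact ⟨⟨u, Submodule.mem_top⟩, rfl, rfl⟩

theorem mem_graph_partialPow_succ {B : X →ₗ.[𝕜] X} {m : ℕ} {u v : X} :
    (u, v) ∈ (partialPow B (m + 1)).graph ↔
      ∃ w, (u, w) ∈ B.graph ∧ (w, v) ∈ (partialPow B m).graph :=
  mem_graph_partialComp

theorem mem_graph_opMatrix {r n : ℕ} {B : Fin r → X →ₗ.[𝕜] X} {S : Fin r → ℕ}
    {z : (Σ j : Fin r, Fin (S j)) → X} {y : Fin n → X} :
    (z, y) ∈ (opMatrix n B S).graph ↔ ∃ w : Fin n → (Σ j : Fin r, Fin (S j)) → X,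
      (∀ (i : Fin n) p, (z p, w i p) ∈ (partialPow (B p.1) ((i : ℕ) - p.2)).graph) ∧
      ∀ i, y i = ∑ p, (i : ℕ).choose p.2 • w i p := by
  constructor
  · intro h
    obtain ⟨a, rfl, rfl⟩ := LinearPMap.mem_graph_iff _ |>.1 h
    have ha := a.2
    simp only [opMatrix, Submodule.mem_iInf] at ha
    refine ⟨fun i p => partialPow (B p.1) ((i : ℕ) - p.2) ⟨a.1 p, ha i p⟩,
      fun i p => LinearPMap.mem_graph (partialPow (B p.1) ((i : ℕ) - p.2)) ⟨a.1 p, ha i p⟩,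
      fun i => ?_⟩
    exact Finset.sum_congr rfl fun p _ => Nat.cast_smul_eq_nsmul 𝕜 _ _
  · rintro ⟨w, hw, hy⟩
    have hd : z ∈ (opMatrix n B S).domain := by
      simp only [opMatrix, Submodule.mem_iInf]
      intro i p
      obtain ⟨a, ha, -⟩ := LinearPMap.mem_graph_iff _ |>.1 (hw i p)
      have ha' : (a : X) = z p := ha
      rw [Submodule.mem_comap, LinearMap.proj_apply]
      exact ha' ▸ a.2
    refine LinearPMap.mem_graph_iff _ |>.2 ⟨⟨z, hd⟩, rfl, funext fun i => ?_⟩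
    refine Eq.trans ?_ (hy i).symm
    refine Finset.sum_congr rfl fun p _ => ?_
    obtain ⟨a, ha, hb⟩ := LinearPMap.mem_graph_iff _ |>.1 (hw i p)
    rw [Nat.cast_smul_eq_nsmul, ← show _ = w i p from hb]
    congr 2
    exact Subtype.ext ha.symm

theorem mem_graph_coeffOp {r n : ℕ} {B : Fin r → X →ₗ.[𝕜] X} {S : Fin r → ℕ}
    (hinj : Function.Injective (opMatrix n B S)) {z : (Σ j : Fin r, Fin (S j)) → X} {y : X}
    (h : (z, lastUnit 𝕜 X n y) ∈ (opMatrix n B S).graph) (p : Σ j : Fin r, Fin (S j)) :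
    (y, z p) ∈ (coeffOp n B S p).graph := by
  have hker : LinearMap.ker (opMatrix n B S).toFun = ⊥ := LinearMap.ker_eq_bot.2 hinj
  obtain ⟨a, rfl, ha⟩ := LinearPMap.mem_graph_iff _ |>.1 h
  have hd : lastUnit 𝕜 X n y ∈ (opMatrix n B S).inverse.domain := by
    rw [LinearPMap.inverse_domain]
    exact ⟨a, ha⟩
  refine LinearPMap.mem_graph_iff _ |>.2 ⟨⟨y, hd⟩, rfl, ?_⟩
  exact congrFun (LinearPMap.inverse_apply_eq hker (y := ⟨_, hd⟩) ha) p

end OperatorMatrix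

/-! ### Inverting the operator matrix. -/

namespace SymbolCalculus

variable {𝕜 : Type*} {X : Type u} [RCLike 𝕜] [NormedAddCommGroup X] [NormedSpace 𝕜 X]
  [NormedSpace ℝ X] {r : ℕ} {T : Fin r → C0Semigroup 𝕜 X} {τ : ℝ}
  {hτ : 0 < τ} {K Y : Type*} [CommRing K] [AddCommGroup Y] [Module K Y]
  (Φ : SymbolCalculus T hτ K Y)

theorem exists_inverses : ∃ e : Fin r → Fin r → K,
    ∀ j l, l ≠ j → e j l * (Φ.b j - Φ.b l) = 1 := by
  have h : ∀ j l, ∃ c : K, l ≠ j → c * (Φ.b j - Φ.b l) = 1 := fun j l => by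
    by_cases hjl : l = j
    · exact ⟨0, fun h => (h hjl).elim⟩
    · obtain ⟨u, hu⟩ := Φ.isUnit_sub j l hjl
      exact ⟨↑u⁻¹, fun _ => by rw [← hu, Units.inv_mul]⟩
  choose e he using h
  exact ⟨e, he⟩

variable [IsScalarTower ℝ 𝕜 X]

theorem ι_const_of_mem_graph_partialPow {j : Fin r} {m : ℕ} {u v : X}
    (h : (u, v) ∈ (partialPow (T j).generator m).graph) :
    Φ.ι (ContinuousMap.const _ v) = Φ.b j ^ m • Φ.ι (ContinuousMap.const _ u) := by
  induction m generalizing u with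
  | zero => rw [mem_graph_partialPow_zero.1 h, pow_zero, one_smul]
  | succ m ih =>
    obtain ⟨w, h1, h2⟩ := mem_graph_partialPow_succ.1 h
    rw [ih h2, pow_succ, mul_smul]
    congr 1
    exact (Φ.gen_iff _ _ _).2 fun t => ((T j).mem_graph_generator _ _).1 h1

/-- The natural domain of a power requires every intermediate power to be defined, so all $b_j^az$
with $a\le m$ have to be genuine functions. -/
theorem mem_graph_partialPow {j : Fin r} {m : ℕ} {z y : C(Icc 0 τ, X)}
    (hz : ∀ a ≤ m, Φ.b j ^ a • Φ.ι z ∈ Φ.ι.range) (hy : Φ.ι y = Φ.b j ^ m • Φ.ι z) (t : Icc 0 τ) :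
    (z t, y t) ∈ (partialPow (T j).generator m).graph := by
  induction m generalizing z with
  | zero =>
    rw [pow_zero, one_smul] at hy
    rw [mem_graph_partialPow_zero, Φ.injective hy]
  | succ m ih =>
    obtain ⟨w, hw⟩ := hz 1 (by omega)
    rw [pow_one] at hw
    refine mem_graph_partialPow_succ.2 ⟨w t,
      ((T j).mem_graph_generator _ _).2 ((Φ.gen_iff _ _ _).1 hw t), ih (fun a ha => ?_) ?_⟩
    · rw [hw, smul_smul, ← pow_succ]
      exact hz _ (by omega)
    · rw [hw, smul_smul, ← pow_succ, hy]

-- The coefficients of the Hermite basis form a right inverse of the symbol matrix, which is also a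
-- left inverse because the matrix is square. Vectors of $X$ enter the calculus as constant
-- functions.
open Polynomial in
theorem injective_opMatrix (Φ : SymbolCalculus T hτ K Y) {n : ℕ} {S : Fin r → ℕ}
    (hn : ∑ l, S l = n) :
    Function.Injective (opMatrix n (fun j => (T j).generator) S) := by
  refine (injective_iff_map_eq_zero (opMatrix n (fun j => (T j).generator) S).toFun).2
    fun z hz => ?_
  obtain ⟨e, he⟩ := Φ.exists_inverses
  obtain ⟨H, c, -, -, -, hX, -⟩ := exists_hermite_basis Φ.b e he S hn
  have hg : ((z : _ → X), (0 : Fin n → X)) ∈ (opMatrix n (fun j => (T j).generator) S).graph :=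
    LinearPMap.mem_graph_iff _ |>.2 ⟨z, rfl, hz⟩
  obtain ⟨w, hw, hsum⟩ := mem_graph_opMatrix.1 hg
  let M : Matrix (Fin n) (Σ j : Fin r, Fin (S j)) K :=
    fun i p => ((i : ℕ).choose p.2 : K) * Φ.b p.1 ^ ((i : ℕ) - p.2)
  let N : Matrix (Σ j : Fin r, Fin (S j)) (Fin n) K := fun p i => (H p).coeff i
  have hMN : M * N = 1 := by
    ext i i'
    have := congrArg (fun q : K[X] => q.coeff i') (hX i i.2)
    simp only [coeff_X_pow, finsetSum_coeff, coeff_C_mul] at this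
    rw [Matrix.mul_apply, ← this, Matrix.one_apply]
    simp only [Fin.ext_iff, eq_comm]
  have hNM : N * M = 1 := (Matrix.mul_eq_one_comm_of_card_eq _ _ _ (by simp [hn])).1 hMN
  have hrow : ∀ i, ∑ p, M i p • Φ.ι (ContinuousMap.const _ (z.1 p)) = 0 := fun i => by
    have h1 : Φ.ι (ContinuousMap.const _ (∑ p : (Σ j : Fin r, Fin (S j)),
        (i : ℕ).choose p.2 • w i p)) = 0 := by
      rw [← hsum i]
      exact map_zero Φ.ι
    have h2 : (ContinuousMap.const (Icc 0 τ) (∑ p : (Σ j : Fin r, Fin (S j)),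
        (i : ℕ).choose p.2 • w i p)) =
        ∑ p : (Σ j : Fin r, Fin (S j)), (i : ℕ).choose p.2 • ContinuousMap.const _ (w i p) := by
      ext t
      simp
    rw [h2, map_sum] at h1
    rw [← h1]
    refine Finset.sum_congr rfl fun p _ => ?_
    rw [map_nsmul, Φ.ι_const_of_mem_graph_partialPow (hw i p), mul_smul, Nat.cast_smul_eq_nsmul]
  refine Subtype.ext (funext fun p => ?_)
  have h1 : Φ.ι (ContinuousMap.const _ (z.1 p)) = 0 := by
    calc Φ.ι (ContinuousMap.const _ (z.1 p))
        = ∑ q, (N * M) p q • Φ.ι (ContinuousMap.const _ (z.1 q)) := by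
          simp [hNM, Matrix.one_apply]
      _ = ∑ i, N p i • ∑ q, M i q • Φ.ι (ContinuousMap.const _ (z.1 q)) := by
          simp only [Matrix.mul_apply, Finset.sum_smul, Finset.smul_sum, mul_smul]
          exact Finset.sum_comm
      _ = 0 := by simp only [hrow, smul_zero, Finset.sum_const_zero]
  exact DFunLike.congr_fun (Φ.injective (h1.trans (map_zero Φ.ι).symm)) ⟨0, left_mem_Icc.2 hτ.le⟩

open Polynomial in
/-- The coefficient functions `Z(n, ·) f` and the partial fraction identity they satisfy. -/
theorem exists_coefficients {n : ℕ} (h0 : 0 < n) {S : Fin r → ℕ} (hS : ∀ j, 0 < S j)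
    (hn : ∑ l, S l = n) {f : ℝ → X}
    (hR : RangesLargeEnough n (fun l => (T l).generator) S τ f)
    (hf : ContinuousOn f (Icc 0 τ)) (F : C(Icc 0 τ, X)) (hF : ∀ t, F t = f t) :
    ∃ Z : (Σ j : Fin r, Fin (S j)) → C(Icc 0 τ, X),
      (∀ p (s : Icc 0 τ), (f s, Z p s) ∈ (coeffOp n (fun j => (T j).generator) S p).graph) ∧
      ∀ y : (Σ j : Fin r, Fin (S j)) → Y,
        (∀ p, (Φ.x - Φ.b p.1) ^ ((p.2 : ℕ) + 1) • y p = Φ.ι (Z p)) →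
        (∏ j, (Φ.x - Φ.b j) ^ S j) • ∑ p, y p = Φ.ι F := by
  obtain ⟨e, he⟩ := Φ.exists_inverses
  obtain ⟨H, c, hc, hHc, -, hX, h1⟩ := exists_hermite_basis Φ.b e he S hn
  have hSn : ∀ j, S j ≤ n := fun j => hn ▸ Finset.single_le_sum (fun _ _ => Nat.zero_le _)
    (Finset.mem_univ j)
  have hmem : ∀ p a, a + 1 + p.2 ≤ n → (Φ.b p.1 ^ a * c p) • Φ.ι F ∈ Φ.ι.range := fun p a ha => by
    have := p.2.2
    exact Φ.mem_range_of_mem_multisetSpan he hn hR hf F hF (by omega) (by omega) (hc p)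
  have hp : ∀ p : (Σ j : Fin r, Fin (S j)), 0 + 1 + (p.2 : ℕ) ≤ n := fun p => by
    have := p.2.2
    have := hSn p.1
    omega
  choose Z hZ using fun p => hmem p 0 (hp p)
  simp only [pow_zero, one_mul] at hZ
  -- For $i<k$ the truncated exponent is $0$ and the zero binomial coefficient discards the term.
  choose V hV using fun (i : Fin n) p => hmem p (i - p.2) (by have := hp p; omega)
  refine ⟨Z, fun p s => ?_, fun y hy => ?_⟩
  · refine mem_graph_coeffOp (Φ.injective_opMatrix hn) (z := fun p => Z p s)
      (mem_graph_opMatrix.2 ⟨fun i p => V i p s, fun i p => ?_, fun i => ?_⟩) p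
    · refine Φ.mem_graph_partialPow (fun a ha => ?_) ?_ s
      · rw [hZ, smul_smul]
        exact hmem p a (by have := hp p; omega)
      · rw [hZ, smul_smul, hV]
    -- The coefficient of degree $n-1$ in the interpolation formula for $X^i$ says that the symbol
    -- matrix maps $c$ to the last unit vector.
    · have hi := congrArg (fun q : K[X] => q.coeff (n - 1)) (hX i i.2)
      simp only [coeff_X_pow, finsetSum_coeff, coeff_C_mul, hHc] at hi
      have hs : Φ.ι (∑ p : (Σ j : Fin r, Fin (S j)), (i : ℕ).choose p.2 • V i p) =
          Φ.ι (if (i : ℕ) + 1 = n then F else 0) := by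
        rw [map_sum]
        calc _ = ∑ p : (Σ j : Fin r, Fin (S j)),
              (((i : ℕ).choose p.2 : K) * Φ.b p.1 ^ ((i : ℕ) - p.2) * c p) • Φ.ι F := by
              refine Finset.sum_congr rfl fun p _ => ?_
              rw [map_nsmul, hV, ← Nat.cast_smul_eq_nsmul K, smul_smul, mul_assoc]
          _ = _ := by
              rw [← Finset.sum_smul, ← hi]
              by_cases h : (i : ℕ) + 1 = n
              · rw [if_pos (by omega), if_pos h, one_smul]
              · rw [if_neg (by omega), if_neg h, zero_smul, map_zero]
      have hs' := DFunLike.congr_fun (Φ.injective hs) s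
      rw [ContinuousMap.sum_apply] at hs'
      refine Eq.trans ?_ hs'.symm
      simp only [lastUnit, LinearMap.pi_apply]
      split_ifs
      · exact (hF s).symm
      · rfl
  · have hx := congrArg (fun q : K[X] => q.eval Φ.x) (h1 h0 hS)
    simp only [eval_one, eval_finsetSum, eval_mul, eval_C, eval_prod, eval_pow, eval_sub, eval_X] at hx
    rw [← one_smul K (Φ.ι F), hx, Finset.sum_smul, Finset.smul_sum]
    refine Finset.sum_congr rfl fun p _ => ?_
    have h2 := p.2.2
    have h3 : (Φ.x - Φ.b p.1) ^ S p.1 =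
        (Φ.x - Φ.b p.1) ^ (S p.1 - 1 - p.2) * (Φ.x - Φ.b p.1) ^ ((p.2 : ℕ) + 1) := by
      rw [← pow_add]
      congr 1
      omega
    rw [← Finset.prod_erase_mul _ _ (Finset.mem_univ p.1), h3, ← mul_assoc, mul_smul, hy, hZ,
      smul_smul, mul_comm (c p)]

end SymbolCalculus

/-! ### The two forms of zero initial data. -/

section InitialData

variable {E : Type*} [NormedAddCommGroup E] [NormedSpace ℝ E]

theorem ContinuousLinearMap.iteratedDerivWithin_comp_left {F : Type*} [NormedAddCommGroup F]
    [NormedSpace ℝ F] (P : E →L[ℝ] F) {g : ℝ → E} {s : Set ℝ} {k : ℕ} (hg : ContDiffOn ℝ k g s)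
    (hs : UniqueDiffOn ℝ s) {t : ℝ} (ht : t ∈ s) :
    iteratedDerivWithin k (fun u => P (g u)) s t = P (iteratedDerivWithin k g s t) := by
  rw [iteratedDerivWithin, iteratedDerivWithin]
  have := P.iteratedFDerivWithin_comp_left (hg t ht) hs ht (i := k) le_rfl
  rw [Function.comp_def] at this
  rw [this]
  rfl

/-- The relation computes row $a+1$ from row $a$; as $R_a$ is injective, it also determines column
$k+1$ from column $k$. -/
theorem zero_row_iff_zero_column {N : ℕ} (d : ℕ → ℕ → E) (R Q : ℕ → E →L[ℝ] E)
    (hR : ∀ a, Function.Injective (R a))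
    (h : ∀ a k, a + k + 1 ≤ N → d (a + 1) k = R a (d a (k + 1)) + Q a (d a k)) :
    (∀ k ≤ N, d 0 k = 0) ↔ ∀ a ≤ N, d a 0 = 0 := by
  constructor
  · intro h0
    have : ∀ a k, a + k ≤ N → d a k = 0 := by
      intro a
      induction a with
      | zero => exact fun k hk => h0 k (by omega)
      | succ a ih =>
        intro k hk
        rw [h a k (by omega), ih _ (by omega), ih _ (by omega), map_zero, map_zero, add_zero]
    exact fun a ha => this a 0 ha
  · intro h0
    have : ∀ k a, a + k ≤ N → d a k = 0 := by
      intro k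
      induction k with
      | zero => exact fun a ha => h0 a ha
      | succ k ih =>
        intro a ha
        have h1 := h a k (by omega)
        rw [ih _ (by omega), ih _ (by omega), map_zero, add_zero] at h1
        exact (map_eq_zero_iff (R a) (hR a)).1 h1.symm
    exact fun k hk => this k 0 (by omega)

/-- The two forms of the zero initial data agree for the first-order system written in terms of
resolvents. -/
theorem iteratedDerivWithin_eq_zero_iff {N : ℕ} {s : Set ℝ} (hs : UniqueDiffOn ℝ s) {t₀ : ℝ}
    (ht₀ : t₀ ∈ s) (w : ℕ → ℝ → E) (R : ℕ → E →L[ℝ] E) (lam : ℝ)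
    (hR : ∀ a, Function.Injective (R a)) (hcomm : ∀ a b x, R a (R b x) = R b (R a x))
    (hw : ∀ a < N, ContDiffOn ℝ 1 (w a) s)
    (h : ∀ a < N, ∀ t ∈ s, R a (lam • w a t - (derivWithin (w a) s t - w (a + 1) t)) = w a t)
    (h0 : ContDiffOn ℝ N (w 0) s) :
    (∀ k ≤ N, iteratedDerivWithin k (w 0) s t₀ = 0) ↔ ∀ a ≤ N, w a t₀ = 0 := by
  let P : ℕ → E →L[ℝ] E := fun a => Nat.rec 1 (fun a Q => Q * R a) a
  have hP0 : P 0 = 1 := rfl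
  have hPs : ∀ a, P (a + 1) = P a * R a := fun a => rfl
  have hPR : ∀ a b x, P a (R b x) = R b (P a x) := by
    intro a b
    induction a with
    | zero => exact fun x => rfl
    | succ a ih =>
      intro x
      rw [hPs, mul_apply_eq_comp, mul_apply_eq_comp, hcomm, ih]
  have hPinj : ∀ a, Function.Injective (P a) := by
    intro a
    -- Injectivity of the product of resolvents lets vanishing of $P_aw_a(t_0)$ be read back as
    -- vanishing of $w_a(t_0)$.
    induction a with
    | zero => exact Function.injective_id
    | succ a ih => exact ih.comp (hR a)
  -- Since $w_a$ is only known to be $C^1$, it is smoothed by $P_a=R_0\cdots R_{a-1}$: then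
  -- $y_{a+1}=R_ay_a'+(1-\lambda R_a)y_a$ involves bounded operators only, and $y_a$ inherits
  -- $C^{N-a}$ from $w_0$.
  let y : ℕ → ℝ → E := fun a t => P a (w a t)
  let Q : ℕ → E →L[ℝ] E := fun a => 1 - lam • R a
  have hy : ∀ a < N, EqOn (y (a + 1)) (fun t => R a (derivWithin (y a) s t) + Q a (y a t)) s := by
    intro a ha t ht
    have h1 : derivWithin (y a) s t = P a (derivWithin (w a) s t) := by
      have := ((hw a ha).differentiableOn one_ne_zero t ht).hasDerivWithinAt
      exact ((P a).hasFDerivAt.comp_hasDerivWithinAt t this).derivWithin (hs t ht)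
    have h2 := congrArg (P a) (h a ha t ht)
    rw [map_sub, map_sub, map_smul, map_sub, map_sub, map_smul, hPR, hPR] at h2
    change P a (R a (w (a + 1) t)) = R a (derivWithin (y a) s t) + Q a (y a t)
    rw [h1]
    change _ = R a (P a (derivWithin (w a) s t)) + (P a (w a t) - lam • R a (P a (w a t)))
    rw [← sub_eq_zero]
    rw [← sub_eq_zero] at h2
    rw [← h2]
    abel
  have hsm : ∀ a ≤ N, ContDiffOn ℝ ((N - a : ℕ) : WithTop ℕ∞) (y a) s := by
    intro a
    induction a with
    | zero => exact fun _ => h0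
    | succ a ih =>
      intro ha
      have h1 := ih (by omega)
      have h2 : (((N - (a + 1) : ℕ) : WithTop ℕ∞)) + 1 = ((N - a : ℕ) : WithTop ℕ∞) := by
        rw [show N - a = N - (a + 1) + 1 by omega]
        push_cast
        rfl
      refine ContDiffOn.congr (ContDiffOn.add ?_ ?_) (hy a (by omega))
      · exact (h1.derivWithin hs h2.le).continuousLinearMap_comp (R a)
      · refine ContDiffOn.continuousLinearMap_comp (Q a) (h1.of_le ?_)
        exact_mod_cast (by omega : N - (a + 1) ≤ N - a)
  have key := zero_row_iff_zero_column (N := N) (fun a k => iteratedDerivWithin k (y a) s t₀) R Q hR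
    fun a k hak => by
      have h1 : ContDiffOn ℝ ((k + 1 : ℕ) : WithTop ℕ∞) (y a) s := (hsm a (by omega)).of_le (by
        exact_mod_cast (by omega : k + 1 ≤ N - a))
      have h2 : ContDiffOn ℝ (k : WithTop ℕ∞) (derivWithin (y a) s) s :=
        h1.derivWithin hs (by push_cast; exact le_rfl)
      have h3 : ContDiffOn ℝ (k : WithTop ℕ∞) (y a) s := h1.of_le (by
        exact_mod_cast (by omega : k ≤ k + 1))
      have h4 : ContDiffOn ℝ (k : WithTop ℕ∞) (fun t => R a (derivWithin (y a) s t)) s :=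
        h2.continuousLinearMap_comp (R a)
      have h5 : ContDiffOn ℝ (k : WithTop ℕ∞) (fun t => Q a (y a t)) s :=
        h3.continuousLinearMap_comp (Q a)
      rw [iteratedDerivWithin_congr (hy a (by omega)) ht₀,
        iteratedDerivWithin_fun_add ht₀ hs (h4 t₀ ht₀) (h5 t₀ ht₀),
        (R a).iteratedDerivWithin_comp_left h2 hs ht₀, (Q a).iteratedDerivWithin_comp_left h3 hs ht₀,
        iteratedDerivWithin_succ']
  refine key.trans (forall_congr' fun a => forall_congr' fun _ => ?_)
  rw [iteratedDerivWithin_zero]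
  exact map_eq_zero_iff (P a) (hPinj a)

end InitialData

/-! ### Continuously differentiable functions as primitives. -/

section ContinuouslyDifferentiable

variable {X : Type*} [NormedAddCommGroup X] [NormedSpace ℝ X] {τ : ℝ}

theorem extend_primitiveOp_zero (hτ : 0 ≤ τ) (v : C(Icc 0 τ, X)) :
    IccExtend hτ (primitiveOp X hτ v) 0 = 0 := by
  rw [IccExtend_of_mem hτ _ (left_mem_Icc.2 hτ), primitiveOp_apply]
  exact intervalIntegral.integral_same

variable [CompleteSpace X]

theorem exists_continuousMap_of_contDiffOn (hτ : 0 < τ) {g : ℝ → X}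
    (hg : ContDiffOn ℝ 1 g (Icc 0 τ)) :
    ∃ G G' : C(Icc 0 τ, X), (∀ t, G t = g t) ∧ (∀ t : Icc 0 τ, G' t = derivWithin g (Icc 0 τ) t) ∧
      G = ContinuousMap.const _ (g 0) + primitiveOp X hτ.le G' := by
  obtain ⟨h1, h2⟩ := (contDiffOn_one_iff_derivWithin (uniqueDiffOn_Icc hτ)).1 hg
  let G : C(Icc 0 τ, X) := ⟨_, hg.continuousOn.domRestrict⟩
  refine ⟨G, ⟨_, h2.domRestrict⟩, fun _ => rfl, fun _ => rfl, ?_⟩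
  refine eq_const_add_primitiveOp hτ.le G _ fun t => ?_
  refine (h1 t t.2).hasDerivWithinAt.congr_of_mem (fun s hs => ?_) t.2
  exact IccExtend_of_mem hτ.le G hs

theorem derivWithin_extend_primitiveOp (hτ : 0 < τ) (v : C(Icc 0 τ, X)) {t : ℝ} (ht : t ∈ Icc 0 τ) :
    derivWithin (IccExtend hτ.le (primitiveOp X hτ.le v)) (Icc 0 τ) t = v ⟨t, ht⟩ :=
  (hasDerivWithinAt_primitiveOp hτ.le v ⟨t, ht⟩).derivWithin (uniqueDiffOn_Icc hτ t ht)

theorem contDiffOn_extend_primitiveOp (hτ : 0 < τ) (v : C(Icc 0 τ, X)) :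
    ContDiffOn ℝ 1 (IccExtend hτ.le (primitiveOp X hτ.le v)) (Icc 0 τ) := by
  refine (contDiffOn_one_iff_derivWithin (uniqueDiffOn_Icc hτ)).2 ⟨fun t ht => ?_, ?_⟩
  · exact (hasDerivWithinAt_primitiveOp hτ.le v ⟨t, ht⟩).differentiableWithinAt
  · refine (continuous_extend hτ.le v).continuousOn.congr fun t ht => ?_
    rw [derivWithin_extend_primitiveOp hτ v ht, IccExtend_of_mem hτ.le _ ht]

end ContinuouslyDifferentiable

theorem prod_smul_of_chain {K Y : Type*} [CommRing K] [AddCommGroup Y] [Module K Y] {n : ℕ}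
    (k : Fin n → K) (y : Fin (n + 1) → Y) (h : ∀ a, k a • y a.castSucc = y a.succ) :
    (∏ a, k a) • y 0 = y (Fin.last n) := by
  induction n with
  | zero => simp
  | succ n ih =>
    have h1 := ih (fun a => k a.castSucc) (fun a => y a.castSucc) fun a => by
      rw [← Fin.succ_castSucc]
      exact h a.castSucc
    rw [Fin.prod_univ_castSucc, mul_comm, mul_smul]
    rw [Fin.castSucc_zero] at h1
    rw [h1, h, Fin.succ_last]

/-! ### Solutions of the factored equation. -/

namespace SymbolCalculus

variable {𝕜 : Type*} {X : Type u} [RCLike 𝕜] [NormedAddCommGroup X] [NormedSpace 𝕜 X]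
  [NormedSpace ℝ X] [IsScalarTower ℝ 𝕜 X] [CompleteSpace X] {r : ℕ} {T : Fin r → C0Semigroup 𝕜 X}
  {τ : ℝ} {hτ : 0 < τ} {K Y : Type*} [CommRing K] [AddCommGroup Y] [Module K Y]

/-- The last factor is solved first. Each solution is a primitive of a continuous function, hence
again a $C^1$ right-hand side for the preceding factor. -/
theorem exists_solution_chain (Φ : SymbolCalculus T hτ K Y) {f : ℝ → X}
    (hf : ContDiffOn ℝ 1 f (Icc 0 τ)) (n : ℕ) (σ : Fin n → Fin r) :
    ∃ v : Fin (n + 1) → ℝ → X, v (Fin.last n) = f ∧ (∀ a, ContDiffOn ℝ 1 (v a) (Icc 0 τ)) ∧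
      ∀ a : Fin n, v a.castSucc 0 = 0 ∧ ∀ t ∈ Icc 0 τ, (T (σ a)).HasGen (v a.castSucc t)
        (derivWithin (v a.castSucc) (Icc 0 τ) t - v a.succ t) := by
  induction n with
  | zero => exact ⟨fun _ => f, rfl, fun _ => hf, fun a => a.elim0⟩
  | succ n ih =>
    obtain ⟨v, h1, h2, h3⟩ := ih fun a => σ a.succ
    obtain ⟨G, G', hG, -, hGG'⟩ := exists_continuousMap_of_contDiffOn hτ (h2 0)
    obtain ⟨y, hy⟩ := Φ.exists_solution (σ 0) G G' _ hGG'
    refine ⟨Fin.cons (IccExtend hτ.le (primitiveOp X hτ.le y)) v, ?_, ?_, ?_⟩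
    · rw [← Fin.succ_last, Fin.cons_succ, h1]
    · refine Fin.cases ?_ fun a => ?_
      · exact contDiffOn_extend_primitiveOp hτ y
      · exact h2 a
    · refine Fin.cases ?_ fun a => ?_
      · refine ⟨extend_primitiveOp_zero hτ.le y, fun t ht => ?_⟩
        have := hy ⟨t, ht⟩
        rw [hG] at this
        simp only [Fin.castSucc_zero, Fin.cons_zero, Fin.cons_succ]
        rw [derivWithin_extend_primitiveOp hτ y ht, IccExtend_of_mem hτ.le _ ht]
        exact this
      · have := h3 a
        simp only [← Fin.succ_castSucc, Fin.cons_succ]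
        exact this

theorem prod_smul_of_isFactoredSolution (Φ : SymbolCalculus T hτ K Y) {n : ℕ} {σ : Fin n → Fin r}
    {f u : ℝ → X} {v : Fin (n + 1) → ℝ → X}
    (h : IsFactoredSolution (fun a => (T (σ a)).generator) τ f u v)
    (h0 : ∀ a : Fin n, v a.castSucc 0 = 0) (F : C(Icc 0 τ, X)) (hF : ∀ t, F t = f t) :
    ∃ U : C(Icc 0 τ, X), (∀ t, U t = u t) ∧ (∏ a, (Φ.x - Φ.b (σ a))) • Φ.ι U = Φ.ι F := by
  have hc : ∀ a, ContinuousOn (v a) (Icc 0 τ) := by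
    refine Fin.lastCases ?_ fun a => (h.contDiffOn a).continuousOn
    refine ContinuousOn.congr ?_ h.finish
    rw [continuousOn_iff_continuous_domRestrict]
    exact F.continuous.congr hF
  let V : Fin (n + 1) → C(Icc 0 τ, X) := fun a => ⟨_, (hc a).domRestrict⟩
  have hV : ∀ a t, V a t = v a t := fun _ _ => rfl
  refine ⟨V 0, fun t => h.start t.2, ?_⟩
  have hlast : V (Fin.last n) = F := by
    ext t
    rw [hV, hF, h.finish t.2]
  rw [← hlast]
  refine prod_smul_of_chain (fun a => Φ.x - Φ.b (σ a)) (fun a => Φ.ι (V a)) fun a => ?_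
  obtain ⟨G, G', hG, hG', hGG'⟩ := exists_continuousMap_of_contDiffOn hτ (h.contDiffOn a)
  have hVG : V a.castSucc = G := ContinuousMap.ext fun t => (hG t).symm
  refine Φ.x_sub_smul_of_solution (v' := G') ?_ fun t => ?_
  · rw [hVG, hGG', h0]
    ext t
    simp
  · rw [hV, hV, hG']
    exact ((T (σ a)).mem_graph_generator _ _).1 (h.step a t t.2)

end SymbolCalculus

theorem hasZeroDerivs_iff {𝕜 X : Type*} [RCLike 𝕜] [NormedAddCommGroup X] [NormedSpace 𝕜 X]
    [NormedSpace ℝ X] [IsScalarTower ℝ 𝕜 X] [CompleteSpace X] {n r : ℕ} (hn : 0 < n)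
    {T : Fin r → C0Semigroup 𝕜 X} {σ : Fin n → Fin r}
    (hcomm : ∀ j k s t, ((T j).op s).comp ((T k).op t) = ((T k).op t).comp ((T j).op s))
    {τ : ℝ} (hτ : 0 < τ) {f u : ℝ → X} {v : Fin (n + 1) → ℝ → X}
    (h : IsFactoredSolution (fun a => (T (σ a)).generator) τ f u v)
    (hu : ContDiffOn ℝ ((n - 1 : ℕ) : WithTop ℕ∞) u (Icc 0 τ)) :
    HasZeroDerivs n τ u ↔ ∀ a : Fin n, v a.castSucc 0 = 0 := by
  obtain ⟨lam, hlam⟩ := (eventually_all.2 fun j => (T j).eventually_exists_isResolvent).exists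
  choose R hR using hlam
  -- The minima only extend the families to all natural indices; the values used are those with the
  -- original indices.
  let w : ℕ → ℝ → X := fun a => v ⟨min a n, by omega⟩
  let R' : ℕ → X →L[ℝ] X := fun a => R (σ ⟨min a (n - 1), by omega⟩)
  have hw : ∀ a (ha : a < n), w a = v (Fin.castSucc ⟨a, ha⟩) := fun a ha =>
    congrArg v (Fin.ext (min_eq_left ha.le))
  have hws : ∀ a (ha : a < n), w (a + 1) = v (Fin.succ ⟨a, ha⟩) := fun a ha =>
    congrArg v (Fin.ext (min_eq_left ha))
  have hR' : ∀ a (ha : a < n), R' a = R (σ ⟨a, ha⟩) := fun a ha =>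
    congrArg (fun b => R (σ b)) (Fin.ext (min_eq_left (by omega)))
  have hw0 : EqOn (w 0) u (Icc 0 τ) := by
    rw [hw 0 hn]
    exact h.start
  have ht₀ : (0 : ℝ) ∈ Icc 0 τ := left_mem_Icc.2 hτ.le
  have key := iteratedDerivWithin_eq_zero_iff (N := n - 1) (uniqueDiffOn_Icc hτ) ht₀ w R' lam
    (fun a => (hR _).injective) (fun a b x => (hR _).comm_of_comm (hR _) (hcomm _ _) x)
    (fun a ha => by rw [hw a (by omega)]; exact h.contDiffOn _)
    (fun a ha t ht => by
      rw [hw a (by omega), hws a (by omega), hR' a (by omega), ← hR]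
      exact ((T _).mem_graph_generator _ _).1 (h.step ⟨a, by omega⟩ t ht))
    (hu.congr hw0)
  constructor
  · rintro ⟨-, h1⟩ a
    have := key.1 (fun k hk => by
      rw [iteratedDerivWithin_congr hw0 ht₀]
      exact h1 k (by omega)) a (by omega)
    rwa [hw a a.2] at this
  · intro h1
    refine ⟨hu, fun k hk => ?_⟩
    rw [← iteratedDerivWithin_congr hw0 ht₀]
    exact key.2 (fun a ha => by rw [hw a (by omega)]; exact h1 _) k (by omega)

theorem eq_zero_of_injective_sub {𝕜 X : Type*} [RCLike 𝕜] [NormedAddCommGroup X] [NormedSpace 𝕜 X]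
    {C D : X →ₗ.[𝕜] X} (h : Function.Injective (C - D)) {x y : X} (h1 : (x, y) ∈ C.graph)
    (h2 : (x, y) ∈ D.graph) : x = 0 := by
  obtain ⟨a, rfl, rfl⟩ := LinearPMap.mem_graph_iff _ |>.1 h1
  obtain ⟨b, hb, hab⟩ := LinearPMap.mem_graph_iff _ |>.1 h2
  have hb' : (b : X) = a := hb
  have hd : (a : X) ∈ (C - D).domain := ⟨a.2, hb' ▸ b.2⟩
  have h0 : (C - D) ⟨a, hd⟩ = 0 := by
    rw [LinearPMap.sub_apply, sub_eq_zero]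
    refine Eq.trans ?_ (hab.symm.trans ?_)
    · rfl
    · exact congrArg D (Subtype.ext hb')
  exact congrArg Subtype.val (h (h0.trans (LinearPMap.map_zero _).symm))

theorem theorem2 {𝕜 X : Type*} [RCLike 𝕜] [NormedAddCommGroup X] [NormedSpace 𝕜 X]
    [NormedSpace ℝ X] [IsScalarTower ℝ 𝕜 X] [CompleteSpace X]
    {n r : ℕ} (hn : 0 < n)
    -- the distinct operators `B_j` with their semigroups, and `A_a = B_(σ a)`, `S_j` times each
    (T : Fin r → C0Semigroup 𝕜 X) (B : Fin r → X →ₗ.[𝕜] X) (hB : ∀ j, B j = (T j).generator)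
    (A : Fin n → X →ₗ.[𝕜] X) (σ : Fin n → Fin r) (hσ : Function.Surjective σ)
    (hA : ∀ a, A a = B (σ a))
    (S : Fin r → ℕ) (hS : ∀ j, S j = (Finset.univ.filter fun a => σ a = j).card)
    -- the semigroups commute
    (hA0 : ∀ j k s t, ((T j).op s).comp ((T k).op t) = ((T k).op t).comp ((T j).op s))
    -- the differences are injective
    (hA1 : ∀ j k, j ≠ k → Function.Injective (B j - B k))
    {τ : ℝ} (hτ : 0 < τ) (f : ℝ → X)
    -- the ranges of the differences are large enough
    (hA2 : RangesLargeEnough n B S τ f)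
    -- the regularity of `f`
    (hf1 : ContDiffOn ℝ 1 f (Set.Icc 0 τ))
    (hf2 : ∃ (a : Fin n) (g : ℝ → X), ContinuousOn g (Set.Icc 0 τ) ∧
      ∀ t ∈ Set.Icc 0 τ, (f t, g t) ∈ (A a).graph)
    (hf0 : f 0 ≠ 0) :
    -- `M_n` is injective, so that the operators `Z(n, ·)` are well defined by `z = M_n⁻¹ h`
    Function.Injective (opMatrix n B S) ∧
    -- the functions `z = Z(n, ·) f` are defined and continuous on `[0, τ]`
    (∃ z : (Σ j : Fin r, Fin (S j)) → ℝ → X,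
      (∀ p, ∀ s ∈ Set.Icc 0 τ, (f s, z p s) ∈ (coeffOp n B S p).graph) ∧
      (∀ p, ContinuousOn (z p) (Set.Icc 0 τ)) ∧
      -- the formula is a solution of the problem with zero initial data, and it is nontrivial
      IsZeroDataSolution A τ f (dAlembert T S z) ∧
      (∃ t ∈ Set.Icc 0 τ, dAlembert T S z t ≠ 0) ∧
      -- every solution of the problem is given by the formula
      (∀ u, IsZeroDataSolution A τ f u → Set.EqOn u (dAlembert T S z) (Set.Icc 0 τ)) ∧
      (∀ u v, IsFactoredSolution A τ f u v → HasZeroDerivs n τ u →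
        Set.EqOn u (dAlembert T S z) (Set.Icc 0 τ))) ∧
    -- the two forms of the zero initial data agree whenever both make sense
    (∀ u v, IsFactoredSolution A τ f u v →
      ContDiffOn ℝ ((n - 1 : ℕ) : WithTop ℕ∞) u (Set.Icc 0 τ) →
      (HasZeroDerivs n τ u ↔ ∀ a : Fin n, v a.castSucc 0 = 0)) := by
  obtain rfl : B = fun j => (T j).generator := funext hB
  obtain rfl : A = fun a => (T (σ a)).generator := funext hA
  obtain ⟨K, _, Y, _, _, ⟨Φ⟩⟩ := exists_symbolCalculus T hA0 (fun j k hjk u v hu hv =>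
    eq_zero_of_injective_sub (hA1 j k hjk) (((T j).mem_graph_generator u v).2 hu)
      (((T k).mem_graph_generator u v).2 hv)) hτ
  have hSpos : ∀ j, 0 < S j := fun j => by
    obtain ⟨a, ha⟩ := hσ j
    rw [hS]
    exact Finset.card_pos.2 ⟨a, Finset.mem_filter.2 ⟨Finset.mem_univ a, ha⟩⟩
  have hSn : ∑ l, S l = n := by
    rw [Finset.sum_congr rfl fun l _ => hS l, ← Finset.card_eq_sum_card_fiberwise
      (fun a _ => Finset.mem_coe.2 (Finset.mem_univ (σ a))), Finset.card_univ, Fintype.card_fin]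
  -- The symbols commute, so the order of the factors is irrelevant and equal ones can be collected.
  have hprod : ∏ a, (Φ.x - Φ.b (σ a)) = ∏ j, (Φ.x - Φ.b j) ^ S j := by
    rw [← Finset.prod_fiberwise Finset.univ σ]
    refine Finset.prod_congr rfl fun j _ => ?_
    rw [hS, ← Finset.prod_const]
    refine Finset.prod_congr rfl fun a ha => ?_
    rw [(Finset.mem_filter.1 ha).2]
  have hunit : IsUnit (∏ j, (Φ.x - Φ.b j) ^ S j) :=
    IsUnit.prod_univ_iff.2 fun j => (Φ.isUnit_x_sub j).pow _
  let F : C(Set.Icc 0 τ, X) := ⟨_, hf1.continuousOn.domRestrict⟩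
  have hF : ∀ t, F t = f t := fun _ => rfl
  obtain ⟨Z, hZ, hQ⟩ := Φ.exists_coefficients hn hSpos hSn hA2 hf1.continuousOn F hF
  let z : (Σ j : Fin r, Fin (S j)) → ℝ → X := fun p => Set.IccExtend hτ.le (Z p)
  let U : C(Set.Icc 0 τ, X) := ∑ p, (T p.1).convC hτ.le p.2 (Z p)
  have hU : ∀ t (ht : t ∈ Set.Icc 0 τ), dAlembert T S z t = U ⟨t, ht⟩ := fun t ht => by
    rw [ContinuousMap.sum_apply, Fintype.sum_sigma]
    rfl
  have hUF : (∏ j, (Φ.x - Φ.b j) ^ S j) • Φ.ι U = Φ.ι F := by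
    rw [map_sum]
    exact hQ _ fun p => Φ.x_sub_pow_smul_convC p.1 p.2 (Z p)
  have huniq : ∀ u v, IsFactoredSolution (fun a => (T (σ a)).generator) τ f u v →
      (∀ a : Fin n, v a.castSucc 0 = 0) → Set.EqOn u (dAlembert T S z) (Set.Icc 0 τ) := by
    intro u v h h0 t ht
    obtain ⟨W, hW, hWF⟩ := Φ.prod_smul_of_isFactoredSolution h h0 F hF
    rw [hprod, ← hUF, hunit.smul_left_cancel] at hWF
    rw [hU t ht, ← Φ.injective hWF]
    exact (hW ⟨t, ht⟩).symm
  have hiff := fun u v (h : IsFactoredSolution (fun a => (T (σ a)).generator) τ f u v) =>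
    hasZeroDerivs_iff hn hA0 hτ h
  refine ⟨Φ.injective_opMatrix hSn, ⟨z, fun p s hs => ?_, fun p => ?_, ?_, ?_, ?_, ?_⟩, hiff⟩
  · simp only [z, Set.IccExtend_of_mem hτ.le _ hs]
    exact hZ p ⟨s, hs⟩
  · exact (continuous_extend hτ.le (Z p)).continuousOn
  -- The formula is not differentiated: a solution exists, and uniqueness identifies it with the
  -- formula.
  · obtain ⟨v, hv1, hv2, hv3⟩ := Φ.exists_solution_chain hf1 n σ
    have hv : IsFactoredSolution (fun a => (T (σ a)).generator) τ f (v 0) v :=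
      ⟨fun _ _ => rfl, fun t _ => congrFun hv1 t, fun a => hv2 a.castSucc,
        fun a t ht => ((T (σ a)).mem_graph_generator _ _).2 ((hv3 a).2 t ht)⟩
    exact ⟨v, ⟨huniq _ v hv fun a => (hv3 a).1, hv.finish, hv.contDiffOn, hv.step⟩,
      fun a => (hv3 a).1⟩
  -- If $U=0$, its defining identity gives $f=0$ on $[0,\tau]$, against $f(0)\ne0$.
  · by_contra! h
    have hU0 : U = 0 := ContinuousMap.ext fun t => (hU t t.2).symm.trans (h t t.2)
    rw [hU0, map_zero, smul_zero, ← map_zero Φ.ι] at hUF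
    exact hf0 (DFunLike.congr_fun (Φ.injective hUF).symm ⟨0, Set.left_mem_Icc.2 hτ.le⟩)
  · rintro u ⟨v, h, h0⟩
    exact huniq u v h h0
  · exact fun u v h hu => huniq u v h ((hiff u v h hu.1).1 hu)
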